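/- **Conventions.** An *LC instance* $\mathcal D$ has a finite set of variables, a finite domain $\mathcal D_x$ for each variable $x$, and finitely many constraints $x=\alpha(y)$ with $\alpha:\mathcal D_y\to\mathcal D_x$. A *minion* $\mathcal R$ is a functor $D\mapsto\mathcal R^{(D)}$, $\alpha\mapsto\mathcal R^{(\alpha)}$ from finite sets to sets; a minion homomorphism is a natural transformation. A *solution of $\mathcal D$ in $\mathcal R$* is a family $r_x\in\mathcal R^{(\mathcal D_x)}$ with $r_x=\mathcal R^{(\alpha)}(r_y)$ for every constraint $x=\alpha(y)$. For a function $h$ on $D$ with values in an abelian group and $\alpha:D\to E$, "summing up" means $(\alpha_*h)(b)=\sum_{a\in\alpha^{-1}(b)}h(a)$. The *weight* $\mathrm w(v)$ of $v\in\mathbb Z_2^N$ is the sum of its coordinates. * $\mathcal Z_2^{(D)}$ is the set of $f:D\to\mathbb Z_2$ with $\sum_a f(a)=1$; minor maps are given by summing up. The *second saturated power* of $\mathcal D$ has as variables the pairs $x_1x_2$ of variables, with domains $\mathcal D_{x_1}\times\mathcal D_{x_2}$, and as constraints all products $\alpha_1\times\alpha_2$ of two constraints of $\mathcal D$ (the constraints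 $x=\mathrm{id}(x)$ being added to $\mathcal D$ first) and all maps $\sigma^*:(d_1,d_2)\mapsto(d_{\sigma(1)},d_{\sigma(2)})$ for $\sigma:\{1,2\}\to\{1,2\}$. * $\mathcal V_2\text{-}\mathbb Z_2^{(D)}$ is the set of triples $(V,\mathbf i,\mathbf v)$ with $V$ a subspace of some $\mathbb Z_2^N$, $\mathbf i=(1,\dots,1)\in V$, $\mathrm w(\mathbf i)=1$, $\mathbf v:D\to V$, $\sum_a\mathbf v(a)=\mathbf i$ and $\mathbf v(a)\cdot\mathbf v(b)=0$ for $a\ne b$; $\alpha$ acts by summing up $\mathbf v$. * $\mathcal M^{(D)}$ is the set of pairs $f:D\to\mathbb Z_2$, $g:D\times D\to\mathbb Z_2$ with $\sum_a f(a)=1$, $\sum_{a,b}g(a,b)=0$ and $g(a,b)+g(b,a)=f(a)f(b)$ for $a\neq b$; minor maps are given by summing up both functions. * For a finite relational structure $\mathbb A$, $\mathrm{Pol}(\mathbb A)^{(D)}$ is the set of homomorphisms $\mathbb A^D\to\mathbb A$, with $\mathrm{Pol}(\mathbb A)^{(\alpha)}(F)(a)=F(a\circ\alpha)$. An instance $\mathcal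 I$ of $\mathrm{CSP}(\mathbb A)$ is a finite list of constraints $x_1\dots x_n\in R$ with $R$ a relation of $\mathbb A$; $\mathrm{lc}(\mathcal I)$ is the LC instance whose variables are the variables of $\mathcal I$ (domain $A$) and its constraints (domain $R$), with the coordinate projections as constraints. $\mathcal R$ *solves* $\mathrm{CSP}(\mathbb A)$ if every instance $\mathcal I$ for which $\mathrm{lc}(\mathcal I)$ has a solution in $\mathcal R$ is solvable. * $\mathbf D_4$ is the dihedral group of order 8. For $m\in\mathbb N\cup\{\infty\}$, $\mathbb D_m$ is the structure on $\mathbf D_4$ whose relations are all cosets of subgroups of $\mathbf D_4^n$, $n\le m$; $\mathbb D'$ is the structure whose relations are all subgroups and all one-element subsets of $\mathbf D_4^n$, for all $n$. * BLP+AIP accepts a CSP instance if its LC instance has both a BLP solution (probability distributions on the domains, compatible with the constraints by summing up) and an AIP solution (integer-valued functions with sum $1$, likewise compatible) such that the latter vanishes wherever the former does. Singl(BLP+AIP) starts with the full domains and repeatedly removes a value $a$ from the current domain of a variable $x$ if BLP+AIP rejects the current instance with $x=a$ added; it accepts if it ends with all domains nonempty. **Theorem.** 1. For every $N$, the bilinear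 form $Q(v,w)=\sum_{i<j}v_iw_j$ on $\mathbb Z_2^N$ satisfies $$Q(v,w)+Q(w,v)=\mathrm w(v)\,\mathrm w(w)+v\cdot w\qquad\text{for all }v,w.\tag{$*$}$$ 2. Let $\mathcal D$ be an LC instance, $Q$ a bilinear form on $\mathbb Z_2^N$ with $(*)$, $\mathbf i\in\mathbb Z_2^N$ with $\mathrm w(\mathbf i)=1$, and let $\mathbf v_x:\mathcal D_x\to\mathbb Z_2^N$ satisfy $\sum_a\mathbf v_x(a)=\mathbf i$ for all $x$, $\mathbf v_x(a)\cdot\mathbf v_x(b)=0$ for $a\ne b$, and $\mathbf v_x=\alpha_*\mathbf v_y$ for every constraint $x=\alpha(y)$. Then $$f_x(a)=\mathrm w(\mathbf v_x(a)),\quad g_x(a,a)=Q(\mathbf v_x(a),\mathbf v_x(a)-\mathbf i),\quad g_x(a,b)=Q(\mathbf v_x(a),\mathbf v_x(b))\ (a\ne b)$$ defines a solution of $\mathcal D$ in $\mathcal M$, and moreover $\sum_b g_x(a,b)=0$ for all $x$ and $a$. For any choice, for each $N$, of a form with $(*)$, the same formulas define a minion homomorphism $\mathcal V_2\text{-}\mathbb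 Z_2\to\mathcal M$, again with all sums $\sum_b g(a,b)$ equal to $0$. 3. $\mathcal M$ is isomorphic to $\mathrm{Pol}(\mathbb D')$. $\mathrm{Pol}(\mathbb D_\infty)$ is isomorphic to the subminion of $\mathcal M$ consisting of the pairs with $\sum_b g(a,b)=0$ for every $a$. For every $m$ there is a minion homomorphism $\mathcal M\to\mathrm{Pol}(\mathbb D_m)$. 4. For every $m$ there is a minion homomorphism $\mathcal V_2\text{-}\mathbb Z_2\to\mathrm{Pol}(\mathbb D_m)$; every LC instance with a solution in $\mathcal V_2\text{-}\mathbb Z_2$ has a solution in $\mathrm{Pol}(\mathbb D_m)$; and $\mathcal V_2\text{-}\mathbb Z_2$ solves $\mathrm{CSP}(\mathbb D_m)$. 5. For every $m$, the second level of the $\mathbb Z_2$ relaxation decides $\mathrm{CSP}(\mathbb D_m)$: an instance $\mathcal I$ is solvable if and only if the second saturated power of $\mathrm{lc}(\mathcal I)$ has a solution in $\mathcal Z_2$. 6. For every $m\ge4$, Singl(BLP+AIP) does not solve $\mathrm{CSP}(\mathbb D_m)$: it accepts some unsolvable instance. -/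

import Mathlib

namespace SolvingSquare

/-! ### Minions -/

/-- A minion: a functor from finite sets to sets. -/
structure Minion where
  obj : (D : Type) → [Fintype D] → Type
  map : {D E : Type} → [Fintype D] → [Fintype E] → (D → E) → obj D → obj E
  map_id : ∀ {D : Type} [Fintype D] (r : obj D), map (id : D → D) r = r
  map_comp : ∀ {D E F : Type} [Fintype D] [Fintype E] [Fintype F]
    (β : E → F) (α : D → E) (r : obj D), map (β ∘ α) r = map β (map α r)

/-- A minion homomorphism: a family of functions commuting with all minor maps. -/
structure MinionHom (R S : Minion) where
  app : (D : Type) → [Fintype D] → R.obj D → S.obj D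
  naturality : ∀ {D E : Type} [Fintype D] [Fintype E] (α : D → E) (r : R.obj D),
    app E (R.map α r) = S.map α (app D r)

/-! ### Label Cover instances -/

/-- A Label Cover instance. The `c`-th constraint reads `tgt c = fn c (src c)`. -/
structure LCInstance where
  Var : Type
  [varFintype : Fintype Var]
  dom : Var → Type
  [domFintype : ∀ x, Fintype (dom x)]
  Con : Type
  [conFintype : Fintype Con]
  tgt : Con → Var
  src : Con → Var
  fn : (c : Con) → dom (src c) → dom (tgt c)

attribute [instance] LCInstance.varFintype LCInstance.domFintype LCInstance.conFintype

namespace LCInstance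

/-- `s` is a solution of the `R`-relaxation of `D`. -/
def IsSolutionIn (D : LCInstance) (R : Minion) (s : (x : D.Var) → R.obj (D.dom x)) : Prop :=
  ∀ c : D.Con, s (D.tgt c) = R.map (D.fn c) (s (D.src c))

/-- `D` has a solution in the minion `R`. -/
def SolvableIn (D : LCInstance) (R : Minion) : Prop :=
  ∃ s : (x : D.Var) → R.obj (D.dom x), D.IsSolutionIn R s

/-- `D` with all the constraints `x = id(x)` added. -/
def addId (D : LCInstance) : LCInstance where
  Var := D.Var
  dom := D.dom
  Con := D.Con ⊕ D.Var
  tgt := Sum.elim D.tgt id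
  src := Sum.elim D.src id
  fn := fun c => match c with
    | Sum.inl c => D.fn c
    | Sum.inr _ => id

/-- The `k`-th saturated power: the variables are `k`-tuples of variables, and the constraints are
products of `k` constraints (identities included) and the maps `σ^*` for all `σ : [k] → [k]`. -/
def satPower (D : LCInstance) (k : ℕ) : LCInstance where
  Var := Fin k → D.Var
  dom := fun x => (i : Fin k) → D.dom (x i)
  Con := (Fin k → D.addId.Con) ⊕ ((Fin k → D.Var) × (Fin k → Fin k))
  conFintype :=
    letI : Fintype D.addId.Con := D.addId.conFintype
    inferInstance
  tgt := Sum.elim (fun c i => D.addId.tgt (c i)) (fun p i => p.1 (p.2 i))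
  src := Sum.elim (fun c i => D.addId.src (c i)) (fun p => p.1)
  fn := fun c => match c with
    | Sum.inl c => fun d i => D.addId.fn (c i) (d i)
    | Sum.inr p => fun d i => d (p.2 i)

end LCInstance

/-! ### Summing up along a function -/

open Classical in
/-- `(push α f)(b) = ∑_{a ∈ α⁻¹(b)} f(a)`. -/
noncomputable def push {D E M : Type} [Fintype D] [AddCommMonoid M] (α : D → E) (f : D → M) :
    E → M :=
  fun b => ∑ a with α a = b, f a

section pushLemmas

variable {D E F M : Type} [Fintype D] [AddCommMonoid M]

theorem push_id (f : D → M) : push (id : D → D) f = f := by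
  classical
  funext b
  simp [push, Finset.sum_filter]

theorem push_comp [Fintype E] (β : E → F) (α : D → E) (f : D → M) :
    push (β ∘ α) f = push β (push α f) := by
  classical
  funext b
  simp only [push, Function.comp_apply]
  rw [← Finset.sum_fiberwise_of_maps_to (s := Finset.univ.filter fun a => β (α a) = b)
    (t := Finset.univ.filter fun e => β e = b) (g := α) (by simp)]
  refine Finset.sum_congr rfl fun e he => ?_
  refine Finset.sum_congr ?_ fun _ _ => rfl
  ext a
  simp only [Finset.mem_filter, Finset.mem_univ, true_and] at he ⊢
  constructor
  · rintro ⟨_, h⟩; exact h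
  · intro h; exact ⟨by rw [h, he], h⟩

theorem sum_push [Fintype E] (α : D → E) (f : D → M) : ∑ b, push α f b = ∑ a, f a := by
  classical
  simp only [push]
  exact Finset.sum_fiberwise _ _ _

theorem push_prodMap_apply (α : D → E) (g : D × D → M) (c d : E) :
    push (Prod.map α α) g (c, d) =
      open Classical in ∑ a with α a = c, ∑ b with α b = d, g (a, b) := by
  classical
  simp only [push]
  rw [← Finset.sum_product']
  refine Finset.sum_congr ?_ fun _ _ => rfl
  ext ⟨a, b⟩
  simp [Prod.ext_iff]

end pushLemmas

/-! ### The minions `Z_n` -/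

/-- The minion `Z_n`: functions `D → ℤ/n` with sum `1`. -/
noncomputable def zMinion (n : ℕ) : Minion where
  obj := fun D _ => {f : D → ZMod n // ∑ a, f a = 1}
  map := fun α f => ⟨push α f.1, by rw [sum_push, f.2]⟩
  map_id := fun f => Subtype.ext (push_id f.1)
  map_comp := fun β α f => Subtype.ext (push_comp β α f.1)

/-! ### The vector minions `V_k-Z_p` -/

/-- The weight of a vector: the sum of its coordinates. -/
def weight {p N : ℕ} (v : Fin N → ZMod p) : ZMod p := ∑ j, v j

/-- The elements `(V, i, v)` of `V_k-Z_p^{(D)}`, for `k ≥ 2`. Multiplication of vectors is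
componentwise. -/
@[ext]
structure VectorObj (k p : ℕ) (D : Type) [Fintype D] where
  N : ℕ
  V : Submodule (ZMod p) (Fin N → ZMod p)
  i : Fin N → ZMod p
  v : D → Fin N → ZMod p
  i_mem : i ∈ V
  v_mem : ∀ a, v a ∈ V
  i_eq : i = fun _ => 1
  weight_i : weight i = 1
  sum_v : ∑ a, v a = i
  orth : ∀ a b, a ≠ b → ∀ u : Fin (k - 2) → Fin N → ZMod p, (∀ j, u j ∈ V) →
    weight (v a * v b * ∏ j, u j) = 0
  idem : ∀ a, ∀ u : Fin (k - 2) → Fin N → ZMod p, (∀ j, u j ∈ V) →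
    weight (v a * v a * ∏ j, u j) = weight (v a * ∏ j, u j)

theorem weight_sum {p N : ℕ} {ι : Type} (s : Finset ι) (f : ι → Fin N → ZMod p) :
    weight (∑ a ∈ s, f a) = ∑ a ∈ s, weight (f a) := by
  simp only [weight, Finset.sum_apply]
  exact Finset.sum_comm

/-- The minor map of `V_k-Z_p`: `(V, i, v) ↦ (V, i, push α v)`. -/
noncomputable def VectorObj.map {k p : ℕ} {D E : Type} [Fintype D] [Fintype E] (α : D → E)
    (t : VectorObj k p D) : VectorObj k p E where
  N := t.N
  V := t.V
  i := t.i
  v := push α t.v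
  i_mem := t.i_mem
  v_mem := fun b => by
    classical
    exact Submodule.sum_mem _ fun a _ => t.v_mem a
  i_eq := t.i_eq
  weight_i := t.weight_i
  sum_v := by rw [sum_push, t.sum_v]
  orth := fun c d hcd u hu => by
    classical
    simp only [push]
    rw [Finset.sum_mul_sum, Finset.sum_mul, weight_sum]
    simp only [Finset.sum_mul, weight_sum]
    refine Finset.sum_eq_zero fun a ha => Finset.sum_eq_zero fun b hb => ?_
    refine t.orth a b ?_ u hu
    rintro rfl
    simp only [Finset.mem_filter, Finset.mem_univ, true_and] at ha hb
    exact hcd (ha.symm.trans hb)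
  idem := fun c u hu => by
    classical
    simp only [push]
    rw [Finset.sum_mul_sum, Finset.sum_mul, Finset.sum_mul, weight_sum, weight_sum]
    simp only [Finset.sum_mul, weight_sum]
    refine Finset.sum_congr rfl fun a ha => ?_
    rw [Finset.sum_eq_single a (fun b _ hb => t.orth a b hb.symm u hu) (fun h => absurd ha h)]
    exact t.idem a u hu

/-- The vector minion `V_k-Z_p`. -/
noncomputable def vectorMinion (k p : ℕ) : Minion where
  obj := fun D _ => VectorObj k p D
  map := fun α t => t.map α
  map_id := fun t => VectorObj.ext rfl HEq.rfl HEq.rfl (heq_of_eq (push_id t.v))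
  map_comp := fun β α t => VectorObj.ext rfl HEq.rfl HEq.rfl (heq_of_eq (push_comp β α t.v))

/-- A family of vectors `v_x(a) ∈ Z_2^N` attached to the points of `D` which is a solution of the
vector relaxation with common sum `i`. -/
structure IsVectorSolution (D : LCInstance) {N : ℕ} (i : Fin N → ZMod 2)
    (v : (x : D.Var) → D.dom x → Fin N → ZMod 2) : Prop where
  weight_i : weight i = 1
  sum_v : ∀ x, ∑ a, v x a = i
  orth : ∀ x a b, a ≠ b → v x a ⬝ᵥ v x b = 0
  constr : ∀ c, v (D.tgt c) = push (D.fn c) (v (D.src c))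

/-- The identity `Q(v,w) + Q(w,v) = w(v) w(w) + v · w` for a bilinear form on `Z_2^N`. -/
def IsRoundingForm {N : ℕ} (Q : LinearMap.BilinForm (ZMod 2) (Fin N → ZMod 2)) : Prop :=
  ∀ v w, Q v w + Q w v = weight v * weight w + v ⬝ᵥ w

/-! ### The minion `M` of pairs `(f, g)` -/

/-- The elements `(f, g)` of `M^{(D)}`. -/
@[ext]
structure SquareObj (D : Type) [Fintype D] where
  f : D → ZMod 2
  g : D × D → ZMod 2
  sum_f : ∑ a, f a = 1
  sum_g : ∑ q, g q = 0
  symm : ∀ a b, a ≠ b → g (a, b) + g (b, a) = f a * f b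

/-- The minion `M`; minor maps are given by summing up. -/
noncomputable def squareMinion : Minion where
  obj := fun D _ => SquareObj D
  map := fun α t =>
    { f := push α t.f
      g := push (Prod.map α α) t.g
      sum_f := by rw [sum_push, t.sum_f]
      sum_g := by rw [sum_push, t.sum_g]
      symm := fun c d hcd => by
        classical
        rw [push_prodMap_apply, push_prodMap_apply]
        conv_lhs => rw [add_comm, Finset.sum_comm, ← Finset.sum_add_distrib]
        simp only [push, Finset.sum_mul_sum]
        refine Finset.sum_congr rfl fun a ha => ?_
        rw [← Finset.sum_add_distrib]
        refine Finset.sum_congr rfl fun b hb => ?_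
        rw [add_comm]
        refine t.symm a b ?_
        rintro rfl
        simp only [Finset.mem_filter, Finset.mem_univ, true_and] at ha hb
        exact hcd (ha.symm.trans hb) }
  map_id := fun t => by
    apply SquareObj.ext
    · exact push_id _
    · simp only [Prod.map_id]
      exact push_id _
  map_comp := fun β α t => by
    apply SquareObj.ext
    · exact push_comp _ _ _
    · simp only [← Prod.map_comp_map]
      exact push_comp _ _ _

/-! ### CSP instances, templates, polymorphism minions -/

/-- A CSP instance with finitely many variables, each with its own finite domain, and a finite list
(indexed by `Con`) of constraints `scope c ∈ rel c`. -/
structure CSPInstance where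
  Var : Type
  [varFintype : Fintype Var]
  dom : Var → Type
  [domFintype : ∀ x, Fintype (dom x)]
  Con : Type
  [conFintype : Fintype Con]
  ar : Con → ℕ
  scope : (c : Con) → Fin (ar c) → Var
  rel : (c : Con) → Set ((i : Fin (ar c)) → dom (scope c i))

attribute [instance] CSPInstance.varFintype CSPInstance.domFintype CSPInstance.conFintype

namespace CSPInstance

/-- The instance has a solution. -/
def Solvable (I : CSPInstance) : Prop :=
  ∃ d : (x : I.Var) → I.dom x, ∀ c, (fun i => d (I.scope c i)) ∈ I.rel c

/-- The associated Label Cover instance: one new variable with domain `rel c` for each constraint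
`c`, and the projections as constraints. -/
noncomputable def lc (I : CSPInstance) : LCInstance where
  Var := I.Var ⊕ I.Con
  dom := Sum.elim I.dom (fun c => ↥(I.rel c))
  domFintype := fun y => match y with
    | Sum.inl x => I.domFintype x
    | Sum.inr c => Fintype.ofFinite ↥(I.rel c)
  Con := (c : I.Con) × Fin (I.ar c)
  tgt := fun p => Sum.inl (I.scope p.1 p.2)
  src := fun p => Sum.inr p.1
  fn := fun p r => r.1 p.2

/-- The instance with the domain of each variable `x` shrunk to `S x`. -/
noncomputable def restrict (I : CSPInstance) (S : (x : I.Var) → Set (I.dom x)) : CSPInstance where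
  Var := I.Var
  dom := fun x => ↥(S x)
  domFintype := fun _ => Fintype.ofFinite _
  Con := I.Con
  ar := I.ar
  scope := I.scope
  rel := fun c => {r | (fun i => (r i).1) ∈ I.rel c}

open Classical in
/-- One step of the singleton version of the algorithm with acceptance predicate `Acc`, at the
current domains `S`: for some variable `x` and some value `a` of its domain, the algorithm fails on
the instance with `x = a`, and `a` is removed from the domain of `x`. -/
def SinglStep (Acc : CSPInstance → Prop) (I : CSPInstance)
    (S T : (x : I.Var) → Set (I.dom x)) : Prop :=
  ∃ x, ∃ a ∈ S x, ¬ Acc (I.restrict (Function.update S x {a})) ∧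
    T = Function.update S x (S x \ {a})

/-- The singleton version of an algorithm accepts `I`: starting from the full domains, the pruning
process reaches domains that are all nonempty and cannot be pruned further. -/
def SinglAccepts (Acc : CSPInstance → Prop) (I : CSPInstance) : Prop :=
  ∃ S : (x : I.Var) → Set (I.dom x),
    Relation.ReflTransGen (SinglStep Acc I) (fun _ => Set.univ) S ∧
    (∀ x, (S x).Nonempty) ∧ ¬ ∃ T, SinglStep Acc I S T

end CSPInstance

/-- A finite relational structure; its signature is `Sym` with arities `ar`. -/
structure RelStructure where
  carrier : Type
  [carrierFintype : Fintype carrier]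
  Sym : Type
  ar : Sym → ℕ
  rel : (R : Sym) → Set (Fin (ar R) → carrier)

attribute [instance] RelStructure.carrierFintype

/-- An instance of the CSP over `A`: finitely many variables and a finite list of formal
constraints. -/
structure TemplateInstance (A : RelStructure) where
  Var : Type
  [varFintype : Fintype Var]
  Con : Type
  [conFintype : Fintype Con]
  sym : Con → A.Sym
  scope : (c : Con) → Fin (A.ar (sym c)) → Var

attribute [instance] TemplateInstance.varFintype TemplateInstance.conFintype

/-- The CSP instance obtained by interpreting the symbols in `A`. -/
def TemplateInstance.toCSP {A : RelStructure} (I : TemplateInstance A) : CSPInstance where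
  Var := I.Var
  dom := fun _ => A.carrier
  Con := I.Con
  ar := fun c => A.ar (I.sym c)
  scope := I.scope
  rel := fun c => A.rel (I.sym c)

/-- The relaxation described by `R` solves the CSP over `A`. -/
def Solves (R : Minion) (A : RelStructure) : Prop :=
  ∀ I : TemplateInstance A, I.toCSP.lc.SolvableIn R → I.toCSP.Solvable

/-- `F` is a homomorphism from the `D`-th power of `A` to `A`. -/
def IsPolymorphism (A : RelStructure) {D : Type} (F : (D → A.carrier) → A.carrier) : Prop :=
  ∀ (R : A.Sym) (t : D → Fin (A.ar R) → A.carrier), (∀ d, t d ∈ A.rel R) →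
    (fun i => F fun d => t d i) ∈ A.rel R

/-- The polymorphism minion of `A`. -/
def polMinion (A : RelStructure) : Minion where
  obj := fun D _ => {F : (D → A.carrier) → A.carrier // IsPolymorphism A F}
  map := fun α F => ⟨fun a => F.1 (a ∘ α), fun R t ht => F.2 R (t ∘ α) fun d => ht (α d)⟩
  map_id := fun _ => rfl
  map_comp := fun _ _ _ => rfl

/-! ### The templates associated with the dihedral group `D_4` -/

/-- The dihedral group with 8 elements. -/
abbrev D4 : Type := DihedralGroup 4

/-- `R` is a coset of a subgroup of `D_4^n`. -/
def IsCoset {n : ℕ} (R : Set (Fin n → D4)) : Prop :=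
  ∃ (H : Subgroup (Fin n → D4)) (g : Fin n → D4), R = {x | ∃ h ∈ H, x = g * h}

/-- The structure on `D_4` whose relations are all cosets of subgroups of `D_4^n`, for all
`n ≤ m`. -/
def cosetTemplate (m : ℕ∞) : RelStructure where
  carrier := D4
  Sym := (n : {n : ℕ // (n : ℕ∞) ≤ m}) × {R : Set (Fin n.1 → D4) // IsCoset R}
  ar := fun R => R.1.1
  rel := fun R => R.2.1

/-- The structure on `D_4` whose relations are all subgroups and all one-element subsets of
`D_4^n`, for all `n`. -/
def subgroupTemplate : RelStructure where
  carrier := D4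
  Sym := (n : ℕ) × {R : Set (Fin n → D4) //
    (∃ H : Subgroup (Fin n → D4), R = H) ∨ ∃ g, R = {g}}
  ar := fun R => R.1
  rel := fun R => R.2.1

/-! ### The combination BLP+AIP -/

/-- A probability distribution on `D` together with an integer affine distribution on `D` that
vanishes wherever the former does. -/
@[ext]
structure BLPAIPObj (D : Type) [Fintype D] where
  blp : D → ℝ
  aip : D → ℤ
  nonneg : ∀ a, 0 ≤ blp a
  sum_blp : ∑ a, blp a = 1
  sum_aip : ∑ a, aip a = 1
  support : ∀ a, blp a = 0 → aip a = 0

/-- The minion describing BLP+AIP. -/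
noncomputable def blpAipMinion : Minion where
  obj := fun D _ => BLPAIPObj D
  map := fun α t =>
    { blp := push α t.blp
      aip := push α t.aip
      nonneg := fun b => by
        classical
        exact Finset.sum_nonneg fun a _ => t.nonneg a
      sum_blp := by rw [sum_push, t.sum_blp]
      sum_aip := by rw [sum_push, t.sum_aip]
      support := fun b hb => by
        classical
        simp only [push] at hb ⊢
        rw [Finset.sum_eq_zero_iff_of_nonneg fun a _ => t.nonneg a] at hb
        exact Finset.sum_eq_zero fun a ha => t.support a (hb a ha) }
  map_id := fun t => by
    apply BLPAIPObj.ext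
    · exact push_id _
    · exact push_id _
  map_comp := fun β α t => by
    apply BLPAIPObj.ext
    · exact push_comp _ _ _
    · exact push_comp _ _ _

/-- BLP+AIP accepts the CSP instance `I`. -/
def BLPAIPAccepts (I : CSPInstance) : Prop := I.lc.SolvableIn blpAipMinion

end SolvingSquare

/-! In unitriangular coordinates `(p, q, z)` the product of `D_4` is additive except for one
bilinear term, `z + z' + p q'`. The value of a word therefore depends only on two counts modulo 2:
`f(a)`, the occurrences of `a`, and `g(a,b)`, those of `a` before `b`. The pairs that occur are
exactly those with `g(a,b) + g(b,a) = f(a) f(b)` for `a ≠ b` (`termOp_mem`,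
`exists_termOp_of_mem_closure`). An operation preserving all subgroups is a term operation, as one
sees by applying it to the projections; preserving constants fixes the two total sums. This
identifies `M` with the polymorphisms of subgroups and constants. Preserving cosets means in
addition commuting with left translations, that is, vanishing row sums of `g`, and adding the row
sums to the diagonal is a natural retraction onto such pairs.

A bilinear form whose symmetrization is `w(v) w(w) + v · w` turns orthogonality of vectors into the
defining relation of `M`, and bilinearity makes the rounding commute with summing up. A solution of
the second saturated power is a symmetric matrix `B`; `exists_rounding_vectors` replaces it by
vectors that inherit every linear relation between its rows, hence all constraints, so the same
rounding applies. A polymorphism minion solves its own CSP, which finishes the positive part.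

For the negative part, two copies of a gadget are linked. In an actual solution each copy forces
equal central coordinates at its variables `0` and `4`, and the link asks for total sum `1`. BLP+AIP
can break the equality in one copy, while a prescribed value is met by an actual solution of the
other. -/

namespace SolvingSquare

/-! ### Coordinates on `D_4`

`D_4` is the group of upper unitriangular `3 × 3` matrices over `ZMod 2`. -/

/-- The first coordinate of an element of `D_4`. -/
def coordP : D4 → ZMod 2
  | .r i => (i.val : ZMod 2)
  | .sr i => (i.val : ZMod 2) + 1

/-- The second coordinate of an element of `D_4`. -/
def coordQ : D4 → ZMod 2
  | .r i => (i.val : ZMod 2)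
  | .sr i => (i.val : ZMod 2)

/-- The central coordinate of an element of `D_4`. -/
def coordZ : D4 → ZMod 2
  | .r i => ((i.val + 1).choose 2 : ZMod 2)
  | .sr i => ((i.val / 2 : ℕ) : ZMod 2)

/-- The element of `D_4` with the given coordinates. -/
def ofCoords (p q z : ZMod 2) : D4 :=
  -- The three factors have coordinates `(1,0,0)`, `(0,1,0)`, `(0,0,1)`; the first two already
  -- produce the central term `p * q`, which the last exponent cancels.
  DihedralGroup.sr 0 ^ p.val * DihedralGroup.sr 1 ^ q.val * DihedralGroup.r 2 ^ (z + p * q).val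

@[simp] theorem coordP_ofCoords (p q z : ZMod 2) : coordP (ofCoords p q z) = p := by
  revert p q z; decide

@[simp] theorem coordQ_ofCoords (p q z : ZMod 2) : coordQ (ofCoords p q z) = q := by
  revert p q z; decide

@[simp] theorem coordZ_ofCoords (p q z : ZMod 2) : coordZ (ofCoords p q z) = z := by
  revert p q z; decide

theorem ofCoords_coords (x : D4) : ofCoords (coordP x) (coordQ x) (coordZ x) = x := by
  revert x; decide

theorem D4.ext_coords {x y : D4} (hp : coordP x = coordP y) (hq : coordQ x = coordQ y)
    (hz : coordZ x = coordZ y) : x = y := by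
  rw [← ofCoords_coords x, ← ofCoords_coords y, hp, hq, hz]

@[simp] theorem coordP_mul (x y : D4) : coordP (x * y) = coordP x + coordP y := by
  revert x y; decide

@[simp] theorem coordQ_mul (x y : D4) : coordQ (x * y) = coordQ x + coordQ y := by
  revert x y; decide

-- The term `coordP x * coordQ y` is the only departure from additivity, and the reason why the
-- order of letters matters.
@[simp] theorem coordZ_mul (x y : D4) :
    coordZ (x * y) = coordZ x + coordZ y + coordP x * coordQ y := by
  revert x y; decide

@[simp] theorem coordP_one : coordP 1 = 0 := by decide
@[simp] theorem coordQ_one : coordQ 1 = 0 := by decide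
@[simp] theorem coordZ_one : coordZ 1 = 0 := by decide

@[simp] theorem coordP_inv (x : D4) : coordP x⁻¹ = coordP x := by revert x; decide
@[simp] theorem coordQ_inv (x : D4) : coordQ x⁻¹ = coordQ x := by revert x; decide
@[simp] theorem coordZ_inv (x : D4) : coordZ x⁻¹ = coordZ x + coordP x * coordQ x := by
  revert x; decide

/-! ### Term operations of `D_4` -/

section termOp

variable {D : Type}

/-- The condition `g(a,b) + g(b,a) = f(a) f(b)` for `a ≠ b`. -/
def IsWordPair (f : D → ZMod 2) (g : D × D → ZMod 2) : Prop :=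
  ∀ a b, a ≠ b → g (a, b) + g (b, a) = f a * f b

/-- The second component of the pair encoding the product of two words. -/
def mulSnd (f f' : D → ZMod 2) (g g' : D × D → ZMod 2) : D × D → ZMod 2 :=
  fun q => g q + g' q + f q.1 * f' q.2

/-- Every letter of the first word precedes every letter of the second; the resulting terms `f(a)
f'(b) + f(b) f'(a)` are the mixed terms of the product of the summed counts. -/
theorem IsWordPair.mul {f f' : D → ZMod 2} {g g' : D × D → ZMod 2} (h : IsWordPair f g)
    (h' : IsWordPair f' g') : IsWordPair (f + f') (mulSnd f f' g g') := fun a b hab => by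
  have h1 := h a b hab
  have h2 := h' a b hab
  simp only [mulSnd, Pi.add_apply]
  linear_combination h1 + h2

theorem isWordPair_single [DecidableEq D] (a : D) : IsWordPair (Pi.single a (1 : ZMod 2)) 0 := by
  intro b c hbc
  by_cases hb : b = a
  · subst hb; simp [hbc.symm]
  · simp [Pi.single_apply, hb]

theorem isWordPair_zero : IsWordPair (0 : D → ZMod 2) 0 := fun _ _ _ => by simp

theorem IsWordPair.inv {f : D → ZMod 2} {g : D × D → ZMod 2} (h : IsWordPair f g) :
    IsWordPair f (fun q => g q + f q.1 * f q.2) := fun a b hab => by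
  have h1 := h a b hab
  linear_combination h1 + (f a * f b) * (CharTwo.two_eq_zero (R := ZMod 2))

variable [Fintype D]

/-- The operation of `D_4` encoded by the pair `(f, g)`. For a word with letters in `D`, let `f(a)`
count the occurrences of `a`, and `g(a, b)` those of `a` before `b`, modulo `2`; then this is the
operation defined by the word. -/
def termOp (f : D → ZMod 2) (g : D × D → ZMod 2) (x : D → D4) : D4 :=
  ofCoords (∑ a, f a * coordP (x a)) (∑ a, f a * coordQ (x a))
    (∑ a, f a * coordZ (x a) + ∑ q, g q * (coordP (x q.1) * coordQ (x q.2)))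

theorem termOp_mul (f f' : D → ZMod 2) (g g' : D × D → ZMod 2) (x : D → D4) :
    termOp (f + f') (mulSnd f f' g g') x = termOp f g x * termOp f' g' x := by
  have h : ∑ q : D × D, f q.1 * f' q.2 * (coordP (x q.1) * coordQ (x q.2)) =
      (∑ a, f a * coordP (x a)) * ∑ a, f' a * coordQ (x a) := by
    rw [Finset.sum_mul_sum, Fintype.sum_prod_type]
    exact Finset.sum_congr rfl fun a _ => Finset.sum_congr rfl fun b _ => by ring
  apply D4.ext_coords
  · simp [termOp, add_mul, Finset.sum_add_distrib]
  · simp [termOp, add_mul, Finset.sum_add_distrib]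
  · simp only [termOp, mulSnd, coordZ_ofCoords, coordZ_mul, coordP_ofCoords, coordQ_ofCoords,
      Pi.add_apply, add_mul, Finset.sum_add_distrib, h]
    ring

theorem termOp_zero (x : D → D4) : termOp (0 : D → ZMod 2) 0 x = 1 := by
  apply D4.ext_coords <;> simp [termOp]

theorem termOp_single [DecidableEq D] (a : D) (x : D → D4) :
    termOp (Pi.single a 1) 0 x = x a := by
  apply D4.ext_coords <;> simp [termOp, Pi.single_apply]

/-- The inverse of the operation encoded by `(f, g)`. -/
theorem termOp_inv (f : D → ZMod 2) (g : D × D → ZMod 2) (x : D → D4) :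
    termOp f (fun q => g q + f q.1 * f q.2) x = (termOp f g x)⁻¹ := by
  rw [eq_inv_iff_mul_eq_one, ← termOp_mul]
  have h1 : f + f = 0 := by funext a; exact CharTwo.add_self_eq_zero _
  have h2 : mulSnd f f (fun q => g q + f q.1 * f q.2) g = 0 := by
    funext q
    simp only [mulSnd, Pi.zero_apply]
    linear_combination (g q + f q.1 * f q.2) * (CharTwo.two_eq_zero (R := ZMod 2))
  rw [h1, h2, termOp_zero]

theorem sum_push_mul {E : Type} [Fintype E] (α : D → E) (f : D → ZMod 2) (h : E → ZMod 2) :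
    ∑ b, push α f b * h b = ∑ a, f a * h (α a) := by
  classical
  simp only [push, Finset.sum_mul]
  rw [← Finset.sum_fiberwise Finset.univ α]
  refine Finset.sum_congr rfl fun b _ => Finset.sum_congr rfl fun a ha => ?_
  rw [(Finset.mem_filter.1 ha).2]

theorem termOp_push {E : Type} [Fintype E] (α : D → E) (f : D → ZMod 2) (g : D × D → ZMod 2)
    (x : E → D4) :
    termOp (push α f) (push (Prod.map α α) g) x = termOp f g (x ∘ α) := by
  have h := sum_push_mul (Prod.map α α) g fun q => coordP (x q.1) * coordQ (x q.2)
  simp only [termOp, sum_push_mul, Function.comp_apply, h, Prod.map_fst, Prod.map_snd]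

theorem termOp_const (f : D → ZMod 2) (g : D × D → ZMod 2) (y : D4) :
    termOp f g (fun _ => y) = ofCoords ((∑ a, f a) * coordP y) ((∑ a, f a) * coordQ y)
      ((∑ a, f a) * coordZ y + (∑ q, g q) * (coordP y * coordQ y)) := by
  simp only [termOp, Finset.sum_mul]

/-- Central inputs detect `f`. Inputs with first coordinate supported at `a`, second at `b`, and
zero central coordinate isolate `g(a,b)`. -/
theorem termOp_injective {f f' : D → ZMod 2} {g g' : D × D → ZMod 2}
    (h : ∀ x, termOp f g x = termOp f' g' x) : f = f' ∧ g = g' := by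
  classical
  constructor
  · funext a
    have := congrArg coordZ (h fun d => if d = a then ofCoords 0 0 1 else 1)
    simpa [termOp, apply_ite coordP, apply_ite coordZ, apply_ite coordQ] using this
  · funext ⟨a, b⟩
    have := congrArg coordZ (h fun d =>
      ofCoords (if d = a then 1 else 0) (if d = b then 1 else 0) 0)
    simpa [termOp, Fintype.sum_prod_type] using this

/-! ### Term operations and generated subgroups -/

section generation

variable {ι : Type} (H : Subgroup (ι → D4)) (t : D → ι → D4)

/-- The pairs `(0, g)` whose operation maps `t` into `H`. -/
def centralPairs : AddSubmonoid (D × D → ZMod 2) where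
  carrier := {g | (fun i => termOp 0 g fun d => t d i) ∈ H}
  zero_mem' := by
    change (fun i => termOp 0 0 fun d => t d i) ∈ H
    simp only [termOp_zero]
    exact H.one_mem
  add_mem' := fun {g g'} hg hg' => by
    have h := H.mul_mem hg hg'
    have e : (fun i => termOp 0 (g + g') fun d => t d i) =
        (fun i => termOp 0 g fun d => t d i) * fun i => termOp 0 g' fun d => t d i := by
      funext i
      have e : mulSnd 0 0 g g' = g + g' := by funext q; simp [mulSnd]
      rw [Pi.mul_apply, ← termOp_mul, add_zero, e]
    rw [← e] at h
    exact h

variable {H t}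

theorem termOp_mem_mul {f f' : D → ZMod 2} {g g' : D × D → ZMod 2}
    (h : (fun i => termOp f g fun d => t d i) ∈ H)
    (h' : (fun i => termOp f' g' fun d => t d i) ∈ H) :
    (fun i => termOp (f + f') (mulSnd f f' g g') fun d => t d i) ∈ H := by
  simp only [termOp_mul]
  exact H.mul_mem h h'

/-- The word `aa` has even letter count and exactly one pair `a` before `a`. -/
theorem single_diag_mem_centralPairs [DecidableEq D] (ht : ∀ d, t d ∈ H) (a : D) :
    Pi.single (a, a) 1 ∈ centralPairs H t := by
  have h : (fun i => termOp (Pi.single a 1) 0 fun d => t d i) ∈ H := by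
    simp only [termOp_single]; exact ht a
  have h2 := termOp_mem_mul h h
  change (fun i => termOp 0 _ fun d => t d i) ∈ H
  convert h2 using 4
  · funext b; exact (CharTwo.add_self_eq_zero _).symm
  · funext ⟨b, c⟩
    simp only [mulSnd, Pi.single_apply, Pi.zero_apply, Prod.mk.injEq]
    split_ifs <;> simp_all

theorem single_prod_apply {A : Type} [DecidableEq A] (a b c d : A) :
    (Pi.single (a, b) 1 : A × A → ZMod 2) (c, d) =
      (Pi.single a 1 : A → ZMod 2) c * (Pi.single b 1 : A → ZMod 2) d := by
  simp only [Pi.single_apply, Prod.mk.injEq, ite_and, mul_ite, mul_one, mul_zero]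
  split_ifs <;> rfl

/-- The word `abab` has `a` before `b` three times, `b` before `a` once, and one pair each of `aa`
and `bb`; the squares of the letters remove the diagonal part. -/
theorem single_pair_mem_centralPairs [DecidableEq D] (ht : ∀ d, t d ∈ H) (a b : D) :
    Pi.single (a, b) 1 + Pi.single (b, a) 1 ∈ centralPairs H t := by
  have h : ∀ a, (fun i => termOp (Pi.single a 1) 0 fun d => t d i) ∈ H := fun a => by
    simp only [termOp_single]; exact ht a
  have h1 := termOp_mem_mul (h a) (h b)
  have h2 := termOp_mem_mul h1 h1
  have e : (Pi.single a 1 + Pi.single b 1 + (Pi.single a 1 + Pi.single b 1) : D → ZMod 2) = 0 := by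
    funext c; exact CharTwo.add_self_eq_zero (R := ZMod 2) _
  rw [e] at h2
  have h3 := add_mem (add_mem (single_diag_mem_centralPairs ht a)
    (single_diag_mem_centralPairs ht b)) (show _ ∈ centralPairs H t from h2)
  convert h3 using 1
  funext ⟨c, d⟩
  simp only [mulSnd, single_prod_apply, Pi.add_apply, Pi.zero_apply]
  generalize (Pi.single a 1 : D → ZMod 2) = u
  generalize (Pi.single b 1 : D → ZMod 2) = v
  linear_combination -(u c * u d + v c * v d + u c * v d) * (CharTwo.two_eq_zero (R := ZMod 2))

/-- Symmetric matrices are spanned by the diagonal units and the symmetrized off-diagonal ones. The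
linear order serves only to pick one representative of each pair. -/
theorem mem_centralPairs_of_symm (ht : ∀ d, t d ∈ H) {g : D × D → ZMod 2}
    (hg : ∀ a b, g (a, b) = g (b, a)) : g ∈ centralPairs H t := by
  classical
  let _ : LinearOrder D := LinearOrder.lift' (Fintype.equivFin D) (Equiv.injective _)
  have key : ∀ (c : ZMod 2) {h : D × D → ZMod 2}, h ∈ centralPairs H t →
      c • h ∈ centralPairs H t := fun c h hh => by
    have hc : c = 0 ∨ c = 1 := by revert c; decide
    rcases hc with rfl | rfl
    · rw [zero_smul]; exact zero_mem _
    · rwa [one_smul]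
  have hsum : g = ∑ a, g (a, a) • Pi.single (a, a) (1 : ZMod 2) +
      ∑ q with q.1 < q.2, g q • (Pi.single (q.1, q.2) (1 : ZMod 2) + Pi.single (q.2, q.1) 1) := by
    funext ⟨c, d⟩
    have e1 : ∀ q : D × D, ((q.1 = c ∧ q.2 = d) ↔ q = (c, d)) := fun q => by
      rw [Prod.ext_iff]
    have e2 : ∀ q : D × D, ((q.2 = c ∧ q.1 = d) ↔ q = (d, c)) := fun q => by
      rw [Prod.ext_iff, and_comm]
    simp only [Pi.add_apply, Finset.sum_apply, Pi.smul_apply, Pi.single_apply, Prod.mk.injEq,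
      smul_eq_mul, mul_add, mul_ite, mul_one, mul_zero, Finset.sum_add_distrib,
      @eq_comm D c, @eq_comm D d, e1, e2, Finset.sum_ite_eq', Finset.mem_filter, Finset.mem_univ,
      true_and]
    rcases lt_trichotomy c d with h | h | h
    · simp [h, h.ne, h.not_gt, ite_and]
    · subst h; simp
    · simp [h, h.ne', h.not_gt, ite_and, hg c d]
  rw [hsum]
  exact add_mem (sum_mem fun a _ => key _ (single_diag_mem_centralPairs ht a))
    (sum_mem fun q _ => key _ (single_pair_mem_centralPairs ht q.1 q.2))

/-- Every pair with `g(a,b) + g(b,a) = f(a) f(b)` encodes a term operation, hence preserves all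
subgroups of powers of `D_4`. -/
theorem termOp_mem (ht : ∀ d, t d ∈ H) {f : D → ZMod 2} {g : D × D → ZMod 2}
    (hfg : IsWordPair f g) : (fun i => termOp f g fun d => t d i) ∈ H := by
  classical
  -- Some word realizes `f`: the product of the letters with `f a = 1`, in any order, with whatever
  -- `g₀` results.
  have key : ∀ s : Finset D, ∃ g₀, IsWordPair (∑ a ∈ s, Pi.single a 1) g₀ ∧
      (fun i => termOp (∑ a ∈ s, Pi.single a 1) g₀ fun d => t d i) ∈ H := fun s => by
    induction s using Finset.induction_on with
    | empty =>
      refine ⟨0, isWordPair_zero, ?_⟩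
      simp only [Finset.sum_empty, termOp_zero]
      exact H.one_mem
    | insert a s ha ih =>
      obtain ⟨g₀, h1, h2⟩ := ih
      rw [Finset.sum_insert ha]
      refine ⟨_, (isWordPair_single a).mul h1, termOp_mem_mul ?_ h2⟩
      simp only [termOp_single]; exact ht a
  obtain ⟨g₀, h1, h2⟩ := key (Finset.univ.filter fun a => f a = 1)
  have hf : ∑ a with f a = 1, Pi.single a 1 = f := by
    funext b
    have : ∀ c : ZMod 2, (if c = 1 then (1 : ZMod 2) else 0) = c := by decide
    simp [Finset.sum_apply, Pi.single_apply, this]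
  rw [hf] at h1 h2
  -- Both `g` and `g₀` symmetrize to `f(a) f(b)` off the diagonal, so their difference is symmetric
  -- and amounts to a central factor.
  have h3 : g + g₀ ∈ centralPairs H t := mem_centralPairs_of_symm ht fun a b => by
    by_cases hab : a = b
    · rw [hab]
    · have e1 := hfg a b hab
      have e2 := h1 a b hab
      simp only [Pi.add_apply]
      linear_combination e1 + e2 +
        (f a * f b - g (b, a) - g₀ (b, a)) * (CharTwo.two_eq_zero (R := ZMod 2))
  have h4 := termOp_mem_mul h2 h3
  convert h4 using 4
  · simp
  · funext q
    simp only [mulSnd, Pi.add_apply, Pi.zero_apply]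
    linear_combination - (g₀ q) * (CharTwo.two_eq_zero (R := ZMod 2))

/-- The elements of the subgroup generated by `t` arise from `t` by term operations. -/
theorem exists_termOp_of_mem_closure {h : ι → D4} (hh : h ∈ Subgroup.closure (Set.range t)) :
    ∃ f g, IsWordPair f g ∧ ∀ i, h i = termOp f g fun d => t d i := by
  classical
  induction hh using Subgroup.closure_induction with
  | mem x hx =>
    obtain ⟨d, rfl⟩ := hx
    exact ⟨_, _, isWordPair_single d, fun i => (termOp_single d fun d => t d i).symm⟩
  | one => exact ⟨_, _, isWordPair_zero, fun i => (termOp_zero _).symm⟩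
  | mul x y _ _ hx hy =>
    obtain ⟨f, g, hfg, h1⟩ := hx
    obtain ⟨f', g', hfg', h2⟩ := hy
    exact ⟨_, _, hfg.mul hfg', fun i => by rw [termOp_mul, Pi.mul_apply, h1, h2]⟩
  | inv x _ hx =>
    obtain ⟨f, g, hfg, h1⟩ := hx
    exact ⟨_, _, hfg.inv, fun i => by rw [termOp_inv, Pi.inv_apply, h1]⟩

end generation

end termOp

/-! ### The polymorphisms of `D_4` with subgroups and constants -/

/-- A polymorphism of all subgroups preserves the subgroups of `D_4^ι` for every finite `ι`. -/
theorem subgroupTemplate_pol_mem {D ι : Type} [Finite ι] {F : (D → D4) → D4}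
    (hF : IsPolymorphism subgroupTemplate F) (H : Subgroup (ι → D4)) (t : D → ι → D4)
    (ht : ∀ d, t d ∈ H) : (fun i => F fun d => t d i) ∈ H := by
  obtain ⟨n, ⟨e⟩⟩ := Finite.exists_equiv_fin ι
  let φ : (Fin n → D4) →* (ι → D4) :=
    { toFun := fun x i => x (e i), map_one' := rfl, map_mul' := fun _ _ => rfl }
  have h := hF ⟨n, _, Or.inl ⟨H.comap φ, rfl⟩⟩ (fun d i => t d (e.symm i)) fun d => by
    change (fun i => t d (e.symm (e i))) ∈ H
    simpa using ht d
  change (fun i => F fun d => t d (e.symm (e i))) ∈ H at h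
  simpa using h

theorem subgroupTemplate_pol_idem {D : Type} {F : (D → D4) → D4}
    (hF : IsPolymorphism subgroupTemplate F) (y : D4) : F (fun _ => y) = y :=
  congrFun (hF ⟨1, _, Or.inr ⟨fun _ => y, rfl⟩⟩ (fun _ _ => y) fun _ => rfl) (0 : Fin 1)

/-- View the projections `x ↦ x d` as tuples indexed by `D → D4`. Applied to them, `F` returns its
own table, which must lie in the subgroup they generate. -/
theorem exists_termOp_of_isPolymorphism {D : Type} [Fintype D] {F : (D → D4) → D4}
    (hF : IsPolymorphism subgroupTemplate F) :
    ∃ f g, IsWordPair f g ∧ ∀ x, F x = termOp f g x := by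
  classical
  have h := subgroupTemplate_pol_mem hF (ι := D → D4)
    (Subgroup.closure (Set.range fun d (x : D → D4) => x d)) (fun d x => x d)
    fun d => Subgroup.subset_closure ⟨d, rfl⟩
  exact exists_termOp_of_mem_closure h

theorem termOp_isPolymorphism {D : Type} [Fintype D] (s : SquareObj D) :
    IsPolymorphism subgroupTemplate (termOp s.f s.g) := by
  rintro ⟨n, R, ⟨H, rfl⟩ | ⟨y, rfl⟩⟩ t ht
  · exact termOp_mem (H := H) ht s.symm
  · have h : ∀ i, (fun d => t d i) = fun _ => y i := fun i => by
      funext d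
      rw [show t d = y from ht d]
    change _ = y
    funext i
    rw [h, termOp_const, s.sum_f, s.sum_g]
    simp [ofCoords_coords]

/-- The homomorphism from `M` to the polymorphism minion of `D_4` with subgroups and constants. -/
def squareToPol : MinionHom squareMinion (polMinion subgroupTemplate) where
  app := fun _ _ s => ⟨termOp s.f s.g, termOp_isPolymorphism s⟩
  naturality := fun α s => Subtype.ext (funext fun x => termOp_push α s.f s.g x)

theorem squareToPol_bijective (D : Type) [Fintype D] :
    Function.Bijective (squareToPol.app D) := by
  constructor
  · intro s s' h
    have h' := termOp_injective (fun x => congrFun (congrArg Subtype.val h) x)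
    exact SquareObj.ext h'.1 h'.2
  · rintro ⟨F, hF⟩
    obtain ⟨f, g, hfg, h⟩ := exists_termOp_of_isPolymorphism hF
    have hc : ∀ y, termOp f g (fun _ => y) = y := fun y => by
      rw [← h]; exact subgroupTemplate_pol_idem hF y
    -- Idempotence at the central involution gives `∑ f = 1`; at `(1,1,0)` it gives `∑ g = 0`.
    have h1 := congrArg coordZ (hc (ofCoords 0 0 1))
    have h2 := congrArg coordZ (hc (ofCoords 1 1 0))
    simp only [termOp_const, coordP_ofCoords, coordQ_ofCoords, coordZ_ofCoords, mul_zero, mul_one,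
      add_zero, zero_add] at h1 h2
    exact ⟨⟨f, g, h1, h2, hfg⟩, Subtype.ext (funext fun x => (h x).symm)⟩

/-- The inverse of a bijective minion homomorphism. -/
noncomputable def MinionHom.symm {R S : Minion} (ξ : MinionHom R S)
    (h : ∀ (D : Type) [Fintype D], Function.Bijective (ξ.app D)) : MinionHom S R where
  app := fun D _ => (Equiv.ofBijective _ (h D)).symm
  naturality := fun {D E} _ _ α s => by
    rw [Equiv.symm_apply_eq, Equiv.ofBijective_apply, ξ.naturality]
    congr 1
    exact ((Equiv.ofBijective _ (h D)).apply_symm_apply s).symm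

theorem MinionHom.symm_bijective {R S : Minion} (ξ : MinionHom R S)
    (h : ∀ (D : Type) [Fintype D], Function.Bijective (ξ.app D)) (D : Type) [Fintype D] :
    Function.Bijective ((ξ.symm h).app D) :=
  (Equiv.ofBijective _ (h D)).symm.bijective

theorem MinionHom.symm_app_eq_iff {R S : Minion} (ξ : MinionHom R S)
    (h : ∀ (D : Type) [Fintype D], Function.Bijective (ξ.app D)) {D : Type} [Fintype D]
    (r : R.obj D) (s : S.obj D) : (ξ.symm h).app D s = r ↔ s = ξ.app D r :=
  Equiv.symm_apply_eq (Equiv.ofBijective _ (h D))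

/-- The composition of minion homomorphisms. -/
def MinionHom.comp {R S T : Minion} (ζ : MinionHom S T) (ξ : MinionHom R S) : MinionHom R T where
  app := fun D _ r => ζ.app D (ξ.app D r)
  naturality := fun α r => by rw [ξ.naturality, ζ.naturality]

theorem LCInstance.SolvableIn.map {D : LCInstance} {R S : Minion} (ξ : MinionHom R S)
    (h : D.SolvableIn R) : D.SolvableIn S := by
  obtain ⟨s, hs⟩ := h
  exact ⟨fun x => ξ.app _ (s x), fun c => by
    dsimp only
    rw [hs c, ξ.naturality]⟩

/-! ### The polymorphisms of `D_4` with all cosets -/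

theorem isCoset_coe {n : ℕ} (H : Subgroup (Fin n → D4)) : IsCoset (H : Set (Fin n → D4)) :=
  ⟨H, 1, by ext x; simp⟩

theorem isCoset_singleton {n : ℕ} (y : Fin n → D4) : IsCoset {y} :=
  ⟨⊥, y, by ext x; simp⟩

theorem IsPolymorphism.of_coset {D : Type} {F : (D → D4) → D4}
    (hF : IsPolymorphism (cosetTemplate ⊤) F) : IsPolymorphism subgroupTemplate F := by
  rintro ⟨n, R, hR⟩ t ht
  refine hF ⟨⟨n, le_top⟩, R, ?_⟩ t ht
  rcases hR with ⟨H, rfl⟩ | ⟨y, rfl⟩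
  · exact isCoset_coe H
  · exact isCoset_singleton y

/-- The inclusion of polymorphism minions. -/
def polCosetToSubgroup : MinionHom (polMinion (cosetTemplate ⊤)) (polMinion subgroupTemplate) where
  app := fun _ _ F => ⟨F.1, F.2.of_coset⟩
  naturality := fun _ _ => rfl

/-- A polymorphism of all cosets preserves the cosets in `D_4^ι` for every finite `ι`. -/
theorem cosetTemplate_pol_mem {D ι : Type} [Finite ι] {F : (D → D4) → D4}
    (hF : IsPolymorphism (cosetTemplate ⊤) F) (H : Subgroup (ι → D4)) (y : ι → D4)
    (t : D → ι → D4) (ht : ∀ d, t d ∈ H) :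
    ∃ h ∈ H, ∀ i, F (fun d => y i * t d i) = y i * h i := by
  obtain ⟨n, ⟨e⟩⟩ := Finite.exists_equiv_fin ι
  let φ : (Fin n → D4) →* (ι → D4) :=
    { toFun := fun x i => x (e i), map_one' := rfl, map_mul' := fun _ _ => rfl }
  obtain ⟨h, hh, he⟩ := hF ⟨⟨n, le_top⟩, _, ⟨H.comap φ, fun i => y (e.symm i), rfl⟩⟩
    (fun d i => y (e.symm i) * t d (e.symm i)) fun d => by
      refine ⟨fun i => t d (e.symm i), ?_, rfl⟩
      change (fun i => t d (e.symm (e i))) ∈ H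
      simpa using ht d
  refine ⟨φ h, hh, fun i => ?_⟩
  have h' := congrFun he (e i)
  simp only [Equiv.symm_apply_apply] at h'
  exact h'.trans (congrArg (· * h (e i)) (congrArg y (e.symm_apply_apply i)))

/-- The two sums differ by `f(b) * ∑_{a ≠ b} f(a) = f(b) (1 - f(b))`, which vanishes in `ZMod 2`. -/
theorem sum_col_eq_sum_row {D : Type} [Fintype D] {f : D → ZMod 2} {g : D × D → ZMod 2}
    (hf : ∑ a, f a = 1) (hfg : IsWordPair f g) (b : D) : ∑ a, g (a, b) = ∑ a, g (b, a) := by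
  classical
  have h : ∑ a, (g (a, b) + g (b, a)) = ∑ a, (f a * f b + if a = b then f b * f b else 0) := by
    refine Finset.sum_congr rfl fun a _ => ?_
    by_cases hab : a = b
    · subst hab
      simp [CharTwo.add_self_eq_zero]
    · simp [hab, hfg a b hab]
  have h2 : ∀ c : ZMod 2, c + c * c = 0 := by decide
  rw [Finset.sum_add_distrib, Finset.sum_add_distrib, ← Finset.sum_mul, hf, one_mul] at h
  simp only [Finset.sum_ite_eq', Finset.mem_univ, if_true, h2] at h
  exact CharTwo.add_eq_zero.1 h

/-- Expanding the central coordinate, the unwanted terms involving `y` are multiples of row sums,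
column sums or the total sum of `g`, all zero. This reduces preservation of cosets to that of
subgroups. -/
theorem termOp_mul_left {D : Type} [Fintype D] {f : D → ZMod 2} {g : D × D → ZMod 2}
    (hf : ∑ a, f a = 1) (hfg : IsWordPair f g) (hrow : ∀ a, ∑ b, g (a, b) = 0) (y : D4)
    (x : D → D4) : termOp f g (fun d => y * x d) = y * termOp f g x := by
  have hcol : ∀ b, ∑ a, g (a, b) = 0 := fun b => by rw [sum_col_eq_sum_row hf hfg, hrow]
  apply D4.ext_coords
  · simp [termOp, mul_add, Finset.sum_add_distrib, ← Finset.sum_mul, hf]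
  · simp [termOp, mul_add, Finset.sum_add_distrib, ← Finset.sum_mul, hf]
  · have h1 : ∑ q : D × D, g q * (coordP y * coordQ y) = 0 := by
      rw [← Finset.sum_mul, Fintype.sum_prod_type]; simp [hrow]
    have h2 : ∑ q : D × D, g q * (coordP y * coordQ (x q.2)) = 0 := by
      rw [Fintype.sum_prod_type_right]; simp [← Finset.sum_mul, hcol]
    have h3 : ∑ q : D × D, g q * (coordP (x q.1) * coordQ y) = 0 := by
      rw [Fintype.sum_prod_type]; simp [← Finset.sum_mul, hrow]
    have h4 : ∑ a, f a * (coordP y * coordQ (x a)) = coordP y * ∑ a, f a * coordQ (x a) := by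
      rw [Finset.mul_sum]; exact Finset.sum_congr rfl fun a _ => by ring
    simp only [termOp, coordZ_ofCoords, coordZ_mul, coordP_mul, coordQ_mul, coordQ_ofCoords,
      mul_add, add_mul, Finset.sum_add_distrib, h1, h2, h3, h4, ← Finset.sum_mul, hf]
    ring

theorem termOp_isPolymorphism_coset {D : Type} [Fintype D] (s : SquareObj D)
    (hrow : ∀ a, ∑ b, s.g (a, b) = 0) (m : ℕ∞) :
    IsPolymorphism (cosetTemplate m) (termOp s.f s.g) := by
  rintro ⟨n, R, H, y, rfl⟩ t ht
  choose h hh e using ht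
  refine ⟨fun i => termOp s.f s.g fun d => h d i, termOp_mem hh s.symm, ?_⟩
  funext i
  refine Eq.trans ?_ (termOp_mul_left s.sum_f s.symm hrow (y i) fun d => h d i)
  exact congrArg (termOp s.f s.g) (funext fun d => congrFun (e d) i)

/-- Index tuples by a translation `y` and an argument `x`. Preservation of the coset obtained by
translating the subgroup generated by the projections in `x` forces the operation to commute with
left translations. -/
theorem row_sum_eq_zero_of_isPolymorphism {D : Type} [Fintype D] (s : SquareObj D)
    (h : IsPolymorphism (cosetTemplate ⊤) (termOp s.f s.g)) (a : D) : ∑ b, s.g (a, b) = 0 := by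
  classical
  obtain ⟨k, hk, e⟩ := cosetTemplate_pol_mem h (ι := D4 × (D → D4))
    (Subgroup.closure (Set.range fun d (x : D4 × (D → D4)) => x.2 d)) (fun x => x.1)
    (fun d x => x.2 d) fun d => Subgroup.subset_closure ⟨d, rfl⟩
  obtain ⟨f, g, -, hfg⟩ := exists_termOp_of_mem_closure hk
  -- The element `k` is a word in the `x d` alone, so it does not depend on `y`; taking `y = 1`
  -- identifies it.
  have h1 : ∀ x, termOp s.f s.g x = termOp f g x := fun x => by
    have := e (1, x)
    rw [hfg] at this
    simpa using this
  -- Translation by `(0,1,0)` makes all second coordinates `1`, and first coordinates supported at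
  -- `a` select row `a` of `g`.
  have h2 := e (ofCoords 0 1 0, fun d => ofCoords (if d = a then 1 else 0) 0 0)
  rw [hfg, ← h1] at h2
  have h3 := congrArg coordZ h2
  simpa [termOp, Fintype.sum_prod_type_right] using h3

/-! ### Retraction onto pairs with vanishing row sums -/

open Classical in
/-- The pair `(f, g)` with the row sums of `g` added on the diagonal. -/
noncomputable def SquareObj.normalize {D : Type} [Fintype D] (s : SquareObj D) : SquareObj D where
  f := s.f
  g := fun q => s.g q + if q.1 = q.2 then ∑ b, s.g (q.1, b) else 0
  sum_f := s.sum_f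
  sum_g := by
    have h := s.sum_g
    rw [Fintype.sum_prod_type] at h
    rw [Finset.sum_add_distrib, s.sum_g, Fintype.sum_prod_type]
    simpa using h
  symm := fun a b hab => by simp [hab, hab.symm, s.symm a b hab]

theorem SquareObj.normalize_row {D : Type} [Fintype D] (s : SquareObj D) (a : D) :
    ∑ b, s.normalize.g (a, b) = 0 := by
  classical
  simp only [SquareObj.normalize, Finset.sum_add_distrib, Finset.sum_ite_eq, Finset.mem_univ,
    if_true]
  exact CharTwo.add_self_eq_zero _

theorem push_add {D E M : Type} [Fintype D] [AddCommMonoid M] (α : D → E) (f g : D → M) :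
    push α (fun a => f a + g a) = fun b => push α f b + push α g b := by
  funext b
  simp only [push, Finset.sum_add_distrib]

open Classical in
theorem push_prodMap_diag {D E : Type} [Fintype D] (α : D → E) (h : D → ZMod 2) :
    push (Prod.map α α) (fun q : D × D => if q.1 = q.2 then h q.1 else 0) =
      fun q : E × E => if q.1 = q.2 then push α h q.1 else 0 := by
  funext ⟨c, d⟩
  rw [push_prodMap_apply]
  simp only [Finset.sum_ite_eq, Finset.mem_filter, Finset.mem_univ, true_and, push]
  split_ifs with hcd
  · subst hcd
    exact Finset.sum_congr rfl fun a ha => if_pos (Finset.mem_filter.1 ha).2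
  · exact Finset.sum_eq_zero fun a ha => if_neg fun h => hcd ((Finset.mem_filter.1 ha).2.symm.trans h)

theorem sum_push_prodMap_row {D E : Type} [Fintype D] [Fintype E] (α : D → E)
    (g : D × D → ZMod 2) (c : E) :
    ∑ d, push (Prod.map α α) g (c, d) = push α (fun a => ∑ b, g (a, b)) c := by
  classical
  simp only [push_prodMap_apply]
  rw [Finset.sum_comm]
  exact Finset.sum_congr rfl fun a _ => Finset.sum_fiberwise Finset.univ α fun b => g (a, b)

/-- Taking row sums and placing a function on the diagonal both commute with summing up. -/
theorem SquareObj.normalize_map {D E : Type} [Fintype D] [Fintype E] (α : D → E)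
    (s : SquareObj D) :
    SquareObj.normalize (squareMinion.map α s) = squareMinion.map α s.normalize := by
  classical
  apply SquareObj.ext
  · rfl
  · change (fun q => push (Prod.map α α) s.g q +
      if q.1 = q.2 then ∑ b, push (Prod.map α α) s.g (q.1, b) else 0) =
      push (Prod.map α α) (fun q => s.g q + if q.1 = q.2 then ∑ b, s.g (q.1, b) else 0)
    rw [push_add, push_prodMap_diag α fun a => ∑ b, s.g (a, b)]
    simp only [sum_push_prodMap_row]

/-- The homomorphism from `M` to the polymorphism minion of `D_4` with cosets. -/
noncomputable def squareToPolCoset (m : ℕ∞) :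
    MinionHom squareMinion (polMinion (cosetTemplate m)) where
  app := fun _ _ s => ⟨termOp s.normalize.f s.normalize.g,
    termOp_isPolymorphism_coset _ s.normalize_row m⟩
  naturality := fun α s => Subtype.ext <| funext fun x =>
    (congrArg (fun u : SquareObj _ => termOp u.f u.g x) (SquareObj.normalize_map α s)).trans
      (termOp_push α s.normalize.f s.normalize.g x)

theorem exists_polSubgroup_iso :
    ∃ η : MinionHom (polMinion subgroupTemplate) squareMinion,
      ∀ (D : Type) [Fintype D], Function.Bijective (η.app D) :=
  ⟨squareToPol.symm squareToPol_bijective, squareToPol.symm_bijective _⟩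

theorem exists_polCoset_embedding :
    ∃ η : MinionHom (polMinion (cosetTemplate ⊤)) squareMinion,
      ∀ (D : Type) [Fintype D], Function.Injective (η.app D) ∧
        ∀ s : SquareObj D, (∃ F, η.app D F = s) ↔ ∀ a, ∑ b, s.g (a, b) = 0 := by
  refine ⟨(squareToPol.symm squareToPol_bijective).comp polCosetToSubgroup, fun D _ => ⟨?_, ?_⟩⟩
  · intro F F' h
    have h' := (squareToPol.symm_bijective squareToPol_bijective D).1 h
    exact Subtype.ext (congrArg Subtype.val h' :)
  · intro s
    constructor
    · rintro ⟨F, hF⟩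
      have h := congrArg Subtype.val ((MinionHom.symm_app_eq_iff _ _ _ _).1 hF)
      have hF' : F.1 = termOp s.f s.g := h
      exact row_sum_eq_zero_of_isPolymorphism s (hF' ▸ F.2)
    · intro h
      exact ⟨⟨termOp s.f s.g, termOp_isPolymorphism_coset s h ⊤⟩,
        (MinionHom.symm_app_eq_iff _ _ _ _).2 rfl⟩

/-! ### Solutions in polymorphism minions -/

/-- Evaluate each polymorphism at the identity of its domain. The one attached to a constraint is
applied to all tuples of the relation at once, so its value stays in the relation. -/
theorem solves_polMinion (A : RelStructure) : Solves (polMinion A) A := by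
  rintro I ⟨s, hs⟩
  refine ⟨fun x => (s (Sum.inl x)).1 id, fun c => ?_⟩
  have h := (s (Sum.inr c)).2 (I.sym c) (fun r => r.1) fun r => r.2
  have e : (fun i => (s (Sum.inl (I.scope c i))).1 id) =
      fun i => (s (Sum.inr c)).1 fun r => r.1 i :=
    funext fun i => congrFun (congrArg Subtype.val (hs ⟨c, i⟩)) id
  exact (congrArg (· ∈ A.rel (I.sym c)) e).mpr h

theorem Solves.of_hom {R S : Minion} {A : RelStructure} (ξ : MinionHom R S) (h : Solves S A) :
    Solves R A :=
  fun I hI => h I (hI.map ξ)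

/-! ### Rounding vectors by a bilinear form -/

section rounding

variable {W : Type} [AddCommGroup W] [Module (ZMod 2) W] (Q : LinearMap.BilinForm (ZMod 2) W)
  (w : W →ₗ[ZMod 2] ZMod 2) {D : Type} [Fintype D]

open Classical in
/-- The second component of the rounded pair. -/
noncomputable def roundSnd (v : D → W) (q : D × D) : ZMod 2 :=
  Q (v q.1) (v q.2) + if q.1 = q.2 then Q (v q.1) (∑ c, v c) else 0

/-- By linearity the row of `Q`-values sums to `Q(v_a, ∑ v)`, which is exactly the diagonal
correction. -/
theorem sum_roundSnd (v : D → W) (a : D) : ∑ b, roundSnd Q v (a, b) = 0 := by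
  classical
  simp only [roundSnd, Finset.sum_add_distrib, Finset.sum_ite_eq, Finset.mem_univ, if_true,
    ← map_sum]
  exact CharTwo.add_self_eq_zero _

theorem roundSnd_of_ne (v : D → W) {a b : D} (h : a ≠ b) :
    roundSnd Q v (a, b) = Q (v a) (v b) := by
  simp [roundSnd, h]

theorem roundSnd_diag (v : D → W) (a : D) :
    roundSnd Q v (a, a) = Q (v a) (v a - ∑ c, v c) := by
  simp [roundSnd, map_sub, CharTwo.sub_eq_add]

/-- The pair obtained from the vectors `v` by rounding with the form `Q` and the weight `w`. -/
noncomputable def roundObj (v : D → W) (hw : ∑ a, w (v a) = 1)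
    (hQ : ∀ a b, a ≠ b → Q (v a) (v b) + Q (v b) (v a) = w (v a) * w (v b)) : SquareObj D where
  f := fun a => w (v a)
  g := roundSnd Q v
  sum_f := hw
  sum_g := by
    rw [Fintype.sum_prod_type]
    exact Finset.sum_eq_zero fun a _ => sum_roundSnd Q v a
  symm := fun a b hab => by
    rw [roundSnd_of_ne Q v hab, roundSnd_of_ne Q v hab.symm, hQ a b hab]

theorem push_linear {E M N : Type} [AddCommMonoid M] [AddCommMonoid N] [Module (ZMod 2) M]
    [Module (ZMod 2) N] (L : M →ₗ[ZMod 2] N) (α : D → E) (v : D → M) :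
    push α (fun a => L (v a)) = fun b => L (push α v b) := by
  funext b
  simp only [push, map_sum]

theorem roundSnd_push {E : Type} [Fintype E] (α : D → E) (v : D → W) :
    roundSnd Q (push α v) = push (Prod.map α α) (roundSnd Q v) := by
  classical
  have h1 : push (Prod.map α α) (fun q : D × D => Q (v q.1) (v q.2)) =
      fun q => Q (push α v q.1) (push α v q.2) := by
    funext ⟨c, d⟩
    rw [push_prodMap_apply]
    simp only [push, map_sum, LinearMap.sum_apply]
    exact Finset.sum_comm
  have h2 : push α (fun a => Q (v a) (∑ c, v c)) = fun b => Q (push α v b) (∑ c, v c) :=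
    push_linear (LinearMap.flip Q (∑ c, v c)) α v
  unfold roundSnd
  rw [push_add, h1, push_prodMap_diag α fun a => Q (v a) (∑ c, v c), h2, sum_push]

theorem roundObj_push {E : Type} [Fintype E] (α : D → E) (v : D → W) (hw hQ hw' hQ') :
    roundObj Q w (push α v) hw' hQ' = squareMinion.map α (roundObj Q w v hw hQ) :=
  SquareObj.ext (push_linear w α v).symm (roundSnd_push Q α v)

theorem roundObj_congr {v v' : D → W} (h : v = v') (hw hQ hw' hQ') :
    roundObj Q w v hw hQ = roundObj Q w v' hw' hQ' := by
  subst h; rfl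

end rounding

/-! ### Upper triangular forms -/

section upperForm

variable {S : Type} [Fintype S] [LinearOrder S]

/-- The form `∑_{s < t} A(s,t) u_s v_t`. -/
def upperForm (A : S → S → ZMod 2) : LinearMap.BilinForm (ZMod 2) (S → ZMod 2) :=
  LinearMap.mk₂ (ZMod 2) (fun u v => ∑ s, ∑ t, if s < t then A s t * (u s * v t) else 0)
    (fun u u' v => by
      simp only [← Finset.sum_add_distrib]
      refine Finset.sum_congr rfl fun s _ => Finset.sum_congr rfl fun t _ => ?_
      split_ifs <;> simp; ring)
    (fun c u v => by
      simp only [Finset.smul_sum]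
      refine Finset.sum_congr rfl fun s _ => Finset.sum_congr rfl fun t _ => ?_
      split_ifs <;> simp; ring)
    (fun u v v' => by
      simp only [← Finset.sum_add_distrib]
      refine Finset.sum_congr rfl fun s _ => Finset.sum_congr rfl fun t _ => ?_
      split_ifs <;> simp; ring)
    (fun c u v => by
      simp only [Finset.smul_sum]
      refine Finset.sum_congr rfl fun s _ => Finset.sum_congr rfl fun t _ => ?_
      split_ifs <;> simp; ring)

theorem upperForm_apply (A : S → S → ZMod 2) (u v : S → ZMod 2) :
    upperForm A u v = ∑ s, ∑ t, if s < t then A s t * (u s * v t) else 0 := rfl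

/-- A symmetric matrix with zero diagonal is symmetrized from its upper triangular part. -/
theorem upperForm_add_flip {A : S → S → ZMod 2} (hs : ∀ s t, A s t = A t s) (h0 : ∀ s, A s s = 0)
    (u v : S → ZMod 2) :
    upperForm A u v + upperForm A v u = ∑ s, ∑ t, A s t * (u s * v t) := by
  have e : upperForm A v u = ∑ s, ∑ t, if t < s then A t s * (v t * u s) else 0 := by
    rw [upperForm_apply, Finset.sum_comm]
  rw [e, upperForm_apply, ← Finset.sum_add_distrib]
  refine Finset.sum_congr rfl fun s _ => ?_
  rw [← Finset.sum_add_distrib]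
  refine Finset.sum_congr rfl fun t _ => ?_
  rcases lt_trichotomy s t with h | h | h
  · simp [h, h.not_gt]
  · subst h; simp [h0]
  · simp only [h, h.not_gt, if_true, if_false, zero_add]
    rw [hs, mul_comm (v t)]

/-- The symmetrization sums `v_i w_j` over `i ≠ j`: the product of the weights minus the dot
product. -/
theorem exists_upper_roundingForm (N : ℕ) :
    ∃ Q : LinearMap.BilinForm (ZMod 2) (Fin N → ZMod 2),
      (∀ v w, Q v w = ∑ i, ∑ j ∈ Finset.Ioi i, v i * w j) ∧ IsRoundingForm Q := by
  have hsum : ∀ v w : Fin N → ZMod 2, ∀ i,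
      ∑ j ∈ Finset.Ioi i, v i * w j =
        ∑ j, if i < j then (if i = j then (0 : ZMod 2) else 1) * (v i * w j) else 0 := by
    intro v w i
    rw [← Finset.sum_filter]
    refine Finset.sum_congr (by ext j; simp) fun j hj => ?_
    rw [if_neg (Finset.mem_filter.1 hj).2.ne, one_mul]
  refine ⟨upperForm fun i j => if i = j then (0 : ZMod 2) else 1, fun v w => ?_, fun v w => ?_⟩
  · simp only [upperForm_apply, hsum]
  · rw [upperForm_add_flip (A := fun i j : Fin N => if i = j then (0 : ZMod 2) else 1)
      (fun s t => by simp only [eq_comm]) (fun s => if_pos rfl)]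
    have h : ∀ i, ∑ j, (if i = j then (0 : ZMod 2) else 1) * (v i * w j) =
        ∑ j, v i * w j + v i * w i := fun i => by
      have h' : ∀ j, (if i = j then (0 : ZMod 2) else 1) * (v i * w j) =
          v i * w j + if i = j then v i * w j else 0 := fun j => by
        split_ifs
        · rw [CharTwo.add_self_eq_zero, zero_mul]
        · rw [one_mul, add_zero]
      simp only [h', Finset.sum_add_distrib, Finset.sum_ite_eq, Finset.mem_univ, if_true]
    simp only [h, Finset.sum_add_distrib, weight, Finset.sum_mul_sum, dotProduct]

/-- A symmetric matrix `B` over `ZMod 2` is represented by vectors that satisfy all linear relations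
between the rows of `B`, with the alternating form `B + diag B ⊗ diag B` split by a form `Q`. -/
theorem exists_rounding_vectors {S : Type} [Fintype S] (B : S → S → ZMod 2)
    (hB : ∀ s t, B s t = B t s) :
    ∃ (v : S → S → ZMod 2) (Q : LinearMap.BilinForm (ZMod 2) (S → ZMod 2))
      (w : (S → ZMod 2) →ₗ[ZMod 2] ZMod 2), (∀ s, w (v s) = B s s) ∧
      (∀ s t, Q (v s) (v t) + Q (v t) (v s) = B s s * B t t + B s t) ∧
      ∀ c : S → ZMod 2, (∀ t, ∑ s, c s * B s t = 0) → ∑ s, c s • v s = 0 := by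
  classical
  let _ : LinearOrder S := LinearOrder.lift' (Fintype.equivFin S) (Equiv.injective _)
  let L : (S → ZMod 2) →ₗ[ZMod 2] (S → ZMod 2) := Matrix.vecMulLinear (Matrix.of B)
  have hL : ∀ u t, L u t = ∑ s, u s * B s t := fun u t => rfl
  -- A generalized inverse of `B`. Unit vectors would represent `B` but need not satisfy the
  -- relations between its rows; replacing them by `T (L e_s)` makes each vector a linear function
  -- of its row.
  obtain ⟨T, hT⟩ : ∃ T : (S → ZMod 2) →ₗ[ZMod 2] (S → ZMod 2), ∀ u, L (T (L u)) = L u := by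
    obtain ⟨T₀, hT₀⟩ := L.rangeRestrict.exists_rightInverse_of_surjective L.range_rangeRestrict
    obtain ⟨T, hT⟩ := T₀.exists_extend
    refine ⟨T, fun u => ?_⟩
    have h1 : T (L u) = T₀ (L.rangeRestrict u) := LinearMap.congr_fun hT (L.rangeRestrict u)
    have h2 := LinearMap.congr_fun hT₀ (L.rangeRestrict u)
    rw [h1]
    exact congrArg Subtype.val h2
  let v : S → S → ZMod 2 := fun s => T (L (Pi.single s 1))
  have hv : ∀ s t, ∑ r, v s r * B r t = B s t := fun s t => by
    rw [← hL, hT, hL]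
    simp [Pi.single_apply]
  let w : (S → ZMod 2) →ₗ[ZMod 2] ZMod 2 := ∑ s, B s s • LinearMap.proj s
  have hw : ∀ u, w u = ∑ s, B s s * u s := fun u => by simp [w]
  have hBv : ∀ s t, ∑ r, ∑ q, B r q * (v s r * v t q) = B s t := fun s t => by
    rw [Finset.sum_comm, hB s t, ← hv t s]
    refine Finset.sum_congr rfl fun q _ => ?_
    rw [← hB s q, ← hv s q, Finset.mul_sum]
    exact Finset.sum_congr rfl fun r _ => by ring
  -- In `u B uᵀ` the off-diagonal terms cancel in pairs and `u r * u r = u r`, so the quadratic form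
  -- of `B` is linear.
  have hwB : ∀ u, w u = ∑ r, ∑ q, B r q * (u r * u q) := fun u => by
    have h := upperForm_add_flip (A := fun r q => if r = q then 0 else B r q)
      (fun r q => by simp only [@eq_comm S r, hB r q]) (fun r => if_pos rfl) u u
    rw [CharTwo.add_self_eq_zero] at h
    have h' : ∀ r, ∑ q, B r q * (u r * u q) =
        ∑ q, (if r = q then 0 else B r q) * (u r * u q) + B r r * u r := fun r => by
      have hu : ∀ c : ZMod 2, c * c = c := by decide
      have e : ∀ q, B r q * (u r * u q) = (if r = q then 0 else B r q) * (u r * u q) +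
          if r = q then B r q * (u r * u q) else 0 := fun q => by
        split_ifs
        · rw [zero_mul, zero_add]
        · rw [add_zero]
      rw [Finset.sum_congr rfl fun q _ => e q, Finset.sum_add_distrib]
      simp [hu]
    rw [Finset.sum_congr rfl fun r _ => h' r, Finset.sum_add_distrib, ← h, zero_add, hw]
  -- The matrix `B + diag B ⊗ diag B` is symmetric with zero diagonal, so its strict upper triangle
  -- splits it.
  refine ⟨v, upperForm fun s t => B s t + B s s * B t t, w, fun s => ?_, fun s t => ?_,
    fun c hc => ?_⟩
  · rw [hwB, hBv]
  · have h2 : ∀ c : ZMod 2, c + c * c = 0 := by decide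
    rw [upperForm_add_flip (fun s t => by rw [hB s t]; ring) fun s => h2 _]
    simp only [add_mul, Finset.sum_add_distrib, hBv]
    have h3 : ∑ r, ∑ q, B r r * B q q * (v s r * v t q) = w (v s) * w (v t) := by
      rw [hw, hw, Finset.sum_mul_sum]
      exact Finset.sum_congr rfl fun r _ => Finset.sum_congr rfl fun q _ => by ring
    rw [h3, hwB, hBv, hwB, hBv, add_comm]
  · have h0 : L (∑ s, c s • Pi.single s 1) = 0 := by
      funext t
      rw [hL]
      simpa [Finset.sum_apply, Pi.single_apply] using hc t
    have h1 : ∑ s, c s • v s = T (L (∑ s, c s • Pi.single s 1)) := by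
      simp only [map_sum, map_smul, v]
    rw [h1, h0, map_zero]

end upperForm

/-! ### Rounding solutions of the vector relaxation -/

/-- The weight as a linear form. -/
def weightLin (N : ℕ) : (Fin N → ZMod 2) →ₗ[ZMod 2] ZMod 2 where
  toFun := weight
  map_add' := fun u v => by simp [weight, Finset.sum_add_distrib]
  map_smul' := fun c u => by simp [weight, Finset.mul_sum]

theorem exists_rounding_of_isVectorSolution (D : LCInstance) (N : ℕ)
    (Q : LinearMap.BilinForm (ZMod 2) (Fin N → ZMod 2)) (i : Fin N → ZMod 2)
    (v : (x : D.Var) → D.dom x → Fin N → ZMod 2) (hQ : IsRoundingForm Q)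
    (hv : IsVectorSolution D i v) :
    ∃ s : (x : D.Var) → SquareObj (D.dom x),
      D.IsSolutionIn squareMinion s ∧
      (∀ x a, (s x).f a = weight (v x a)) ∧
      (∀ x a, (s x).g (a, a) = Q (v x a) (v x a - i)) ∧
      (∀ x a b, a ≠ b → (s x).g (a, b) = Q (v x a) (v x b)) ∧
      (∀ x a, ∑ b, (s x).g (a, b) = 0) := by
  have h1 : ∀ x, ∑ a, weightLin N (v x a) = 1 := fun x => by
    rw [← map_sum, hv.sum_v, ← hv.weight_i]; rfl
  have h2 : ∀ x a b, a ≠ b → Q (v x a) (v x b) + Q (v x b) (v x a) =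
      weightLin N (v x a) * weightLin N (v x b) := fun x a b hab => by
    rw [hQ, hv.orth x a b hab, add_zero]; rfl
  refine ⟨fun x => roundObj Q (weightLin N) (v x) (h1 x) (h2 x), fun c => ?_, fun _ _ => rfl,
    fun x a => ?_, fun x a b hab => roundSnd_of_ne Q _ hab, fun x a => sum_roundSnd Q _ a⟩
  · have hc := hv.constr c
    exact (roundObj_congr Q _ hc _ _ (hc ▸ h1 _) (hc ▸ h2 _)).trans
      (roundObj_push Q (weightLin N) (D.fn c) (v (D.src c)) _ _ _ _)
  · rw [← hv.sum_v x]
    exact roundSnd_diag Q (v x) a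

theorem exists_rounding_hom (Q : (N : ℕ) → LinearMap.BilinForm (ZMod 2) (Fin N → ZMod 2))
    (hQ : ∀ N, IsRoundingForm (Q N)) :
    ∃ ξ : MinionHom (vectorMinion 2 2) squareMinion,
      ∀ (D : Type) [Fintype D] (t : VectorObj 2 2 D) (s : SquareObj D), s = ξ.app D t →
        (∀ a, s.f a = weight (t.v a)) ∧
        (∀ a, s.g (a, a) = Q t.N (t.v a) (t.v a - t.i)) ∧
        (∀ a b, a ≠ b → s.g (a, b) = Q t.N (t.v a) (t.v b)) ∧
        (∀ a, ∑ b, s.g (a, b) = 0) := by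
  have h1 : ∀ {D : Type} [Fintype D] (t : VectorObj 2 2 D),
      ∑ a, weightLin t.N (t.v a) = 1 := fun t => by
    rw [← map_sum, t.sum_v, ← t.weight_i]; rfl
  have h2 : ∀ {D : Type} [Fintype D] (t : VectorObj 2 2 D) a b, a ≠ b →
      Q t.N (t.v a) (t.v b) + Q t.N (t.v b) (t.v a) =
        weightLin t.N (t.v a) * weightLin t.N (t.v b) := fun t a b hab => by
    -- For `k = 2` the family `u` is indexed by `Fin 0`, and the product over it is `1`.
    have h := t.orth a b hab (fun _ => 0) fun j => j.elim0
    have h' : t.v a ⬝ᵥ t.v b = 0 := by simpa [weight, dotProduct] using h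
    rw [hQ, h', add_zero]; rfl
  refine ⟨{ app := fun D _ t => roundObj (Q t.N) (weightLin t.N) t.v (h1 t) (h2 t)
            naturality := fun α t =>
              roundObj_push (Q t.N) (weightLin t.N) α t.v _ _ _ _ }, ?_⟩
  rintro D _ t s rfl
  refine ⟨fun _ => rfl, fun a => ?_, fun a b hab => roundSnd_of_ne _ _ hab,
    fun a => sum_roundSnd _ _ a⟩
  rw [← t.sum_v]
  exact roundSnd_diag _ t.v a

theorem nonempty_vectorMinion_hom_square :
    Nonempty (MinionHom (vectorMinion 2 2) squareMinion) := by
  choose Q _ hQ using exists_upper_roundingForm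
  obtain ⟨ξ, -⟩ := exists_rounding_hom Q hQ
  exact ⟨ξ⟩

/-! ### The second level of the `Z_2` relaxation -/

theorem sum_pi_fin_two {M : Type} [AddCommMonoid M] {α : Fin 2 → Type}
    [∀ i, Fintype (α i)] (φ : ((i : Fin 2) → α i) → M) :
    ∑ d, φ d = ∑ a, ∑ b, φ ((piFinTwoEquiv α).symm (a, b)) := by
  rw [← Fintype.sum_prod_type' fun a b => φ ((piFinTwoEquiv α).symm (a, b))]
  exact ((piFinTwoEquiv α).symm.sum_comp φ).symm

theorem push_eq_sum_ite {D E M : Type} [Fintype D] [DecidableEq E] [AddCommMonoid M] (α : D → E)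
    (f : D → M) (b : E) : push α f b = ∑ a, if α a = b then f a else 0 := by
  rw [← Finset.sum_filter]
  exact Finset.sum_congr (by ext; simp) fun _ _ => rfl

/-- A solution of the second saturated power in `Z_2` is a symmetric matrix indexed by all pairs
of a variable and a value. -/
theorem exists_matrix_of_satPower (D : LCInstance) (h : (D.satPower 2).SolvableIn (zMinion 2)) :
    ∃ B : ((x : D.Var) × D.dom x) → ((x : D.Var) × D.dom x) → ZMod 2,
      (∀ p q, B p q = B q p) ∧ (∀ x a b, a ≠ b → B ⟨x, a⟩ ⟨x, b⟩ = 0) ∧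
      (∀ x, ∑ a, B ⟨x, a⟩ ⟨x, a⟩ = 1) ∧
      ∀ c b q, B ⟨D.tgt c, b⟩ q = push (D.fn c) (fun a => B ⟨D.src c, a⟩ q) b := by
  classical
  obtain ⟨s, hs⟩ := h
  let u : (x : Fin 2 → D.Var) → ((i : Fin 2) → D.dom (x i)) → ZMod 2 := fun x => (s x).1
  have hsum : ∀ x, ∑ d, u x d = 1 := fun x => (s x).2
  have hσ : ∀ (x : Fin 2 → D.Var) (σ : Fin 2 → Fin 2),
      u (fun i => x (σ i)) = push (fun d i => d (σ i)) (u x) :=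
    fun x σ => congrArg Subtype.val (hs (Sum.inr (x, σ)))
  have hcon : ∀ k : Fin 2 → D.addId.Con, u (fun i => D.addId.tgt (k i)) =
      @push ((i : Fin 2) → D.dom (D.addId.src (k i))) _ _ (D.satPower 2 |>.domFintype _) _
        (fun d i => D.addId.fn (k i) (d i)) (u fun i => D.addId.src (k i)) :=
    fun k => congrArg Subtype.val (hs (Sum.inl k))
  clear_value u
  -- Collecting all values in one function of two (variable, value) pairs avoids transport between
  -- dependent domains.
  let H : (Fin 2 → (x : D.Var) × D.dom x) → ZMod 2 :=
    fun P => u (fun i => (P i).1) fun i => (P i).2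
  have hH : ∀ P, H P = H ![P 0, P 1] := fun P => congrArg H <| by
    funext i; fin_cases i <;> rfl
  have hB : ∀ (x : Fin 2 → D.Var) (d : (i : Fin 2) → D.dom (x i)),
      u x d = H ![⟨x 0, d 0⟩, ⟨x 1, d 1⟩] := fun x d => hH fun i => ⟨x i, d i⟩
  -- The constant map `σ = 0` sends every pair to a diagonal one, so the distribution at `(x, x)` is
  -- supported on the diagonal.
  have hdiag : ∀ x a b, a ≠ b → H ![⟨x, a⟩, ⟨x, b⟩] = 0 := fun x a b hab => by
    have h := congrFun (hσ (fun _ => x) fun _ => 0) ![a, b]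
    rw [hB, push_eq_sum_ite] at h
    refine h.trans (Finset.sum_eq_zero fun d' _ => if_neg fun e => ?_)
    exact hab ((congrFun e 0).symm.trans (congrFun e 1))
  refine ⟨fun p q => H ![p, q], fun p q => ?_, hdiag, fun x => ?_, fun c b q => ?_⟩
  · let x : Fin 2 → D.Var := fun i => (![p, q] i).1
    have h := congrFun (hσ x ![1, 0]) fun i => (![p, q] (![1, 0] i)).2
    rw [push_eq_sum_ite, Finset.sum_eq_single fun i => (![p, q] i).2, if_pos rfl, hB, hB] at h
    · exact h.symm
    · intro d' _ hd'
      refine if_neg fun e => hd' ?_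
      funext i
      fin_cases i
      · exact congrFun e 1
      · exact congrFun e 0
    · exact fun h => absurd (Finset.mem_univ _) h
  · have h := hsum fun _ => x
    rw [sum_pi_fin_two] at h
    rw [← h]
    refine Finset.sum_congr rfl fun a _ => ?_
    rw [Finset.sum_eq_single a (fun b _ hb => (hB _ _).trans (hdiag x a b hb.symm))
      (fun ha => absurd (Finset.mem_univ a) ha)]
    exact (hB (fun _ => x) ((piFinTwoEquiv fun _ => D.dom x).symm (a, a))).symm
  · let k : Fin 2 → D.addId.Con := ![Sum.inl c, Sum.inr q.1]
    let xs : Fin 2 → D.Var := fun i => D.addId.src (k i)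
    let xt : Fin 2 → D.Var := fun i => D.addId.tgt (k i)
    let φ : ((i : Fin 2) → D.dom (xs i)) → (i : Fin 2) → D.dom (xt i) :=
      fun d i => D.addId.fn (k i) (d i)
    let d : (i : Fin 2) → D.dom (xt i) := (piFinTwoEquiv _).symm (b, q.2)
    have h : u xt d = push φ (u xs) d := congrFun (hcon k) d
    rw [hB, push_eq_sum_ite, sum_pi_fin_two] at h
    refine h.trans ?_
    rw [push_eq_sum_ite]
    refine Finset.sum_congr rfl fun a _ => ?_
    have e : ∀ b', φ ((piFinTwoEquiv fun i => D.dom (xs i)).symm (a, b')) = d ↔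
        D.fn c a = b ∧ b' = q.2 := fun b' => by
      constructor
      · intro e; exact ⟨congrFun e 0, congrFun e 1⟩
      · rintro ⟨e1, e2⟩
        funext i
        fin_cases i
        · exact e1
        · exact e2
    refine (Finset.sum_eq_single q.2 (fun b' _ hb' => if_neg fun h => hb' ((e b').1 h).2)
      (fun ha => absurd (Finset.mem_univ _) ha)).trans ?_
    by_cases hab : D.fn c a = b
    · exact (if_pos ((e q.2).2 ⟨hab, rfl⟩)).trans ((hB _ _).trans (if_pos hab).symm)
    · exact (if_neg fun h => hab ((e q.2).1 h).1).trans (if_neg hab).symm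

/-- Vanishing of `B` off the diagonal within a variable plays the role of orthogonality. The sums of
the vectors at different variables need not be compared: the rounding uses each variable's own sum.
-/
theorem solvableIn_square_of_satPower (D : LCInstance)
    (h : (D.satPower 2).SolvableIn (zMinion 2)) : D.SolvableIn squareMinion := by
  classical
  obtain ⟨B, hsymm, hdiag, hsum, hcon⟩ := exists_matrix_of_satPower D h
  obtain ⟨v, Q, w, hw, hQ, hrel⟩ := exists_rounding_vectors B hsymm
  have h1 : ∀ x, ∑ a, w (v ⟨x, a⟩) = 1 := fun x => by simp only [hw, hsum]
  have h2 : ∀ x (a b : D.dom x), a ≠ b → Q (v ⟨x, a⟩) (v ⟨x, b⟩) + Q (v ⟨x, b⟩) (v ⟨x, a⟩) =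
      w (v ⟨x, a⟩) * w (v ⟨x, b⟩) := fun x a b hab => by
    rw [hQ, hdiag x a b hab, add_zero, hw, hw]
  refine ⟨fun x => roundObj Q w (fun a => v ⟨x, a⟩) (h1 x) (h2 x), fun c => ?_⟩
  have hc : (fun b => v ⟨D.tgt c, b⟩) = push (D.fn c) fun a => v ⟨D.src c, a⟩ := by
    funext b
    -- By `hcon` this combination of rows of `B` is zero, so the same combination of vectors is
    -- zero.
    have h3 := hrel (Pi.single ⟨D.tgt c, b⟩ 1 -
      ∑ a with D.fn c a = b, Pi.single ⟨D.src c, a⟩ 1) fun t => by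
        simp only [Pi.sub_apply, Finset.sum_apply, sub_mul, Finset.sum_sub_distrib, Finset.sum_mul]
        rw [Finset.sum_comm]
        simp only [Pi.single_apply, ite_mul, one_mul, zero_mul, Finset.sum_ite_eq',
          Finset.mem_univ, if_true]
        rw [sub_eq_zero, hcon]
        rfl
    simp only [Pi.sub_apply, Finset.sum_apply, sub_smul, Finset.sum_sub_distrib,
      Finset.sum_smul] at h3
    rw [Finset.sum_comm] at h3
    simp only [Pi.single_apply, ite_smul, one_smul, zero_smul, Finset.sum_ite_eq',
      Finset.mem_univ, if_true] at h3
    exact sub_eq_zero.1 h3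
  exact (roundObj_congr Q _ hc _ _ (by rw [← hc]; exact h1 _) (by rw [← hc]; exact h2 _)).trans
    (roundObj_push Q w (D.fn c) (fun a => v ⟨D.src c, a⟩) _ _ _ _)

/-! ### Solutions of the saturated power from actual solutions -/

/-- The point mass at `a`. -/
noncomputable def pointMass {D : Type} (a : D) : D → ZMod 2 :=
  open Classical in Pi.single a 1

theorem sum_pointMass {D : Type} [Fintype D] (a : D) : ∑ b, pointMass a b = 1 := by
  classical
  simp [pointMass, Pi.single_apply]

theorem push_pointMass {D E : Type} [Fintype D] (α : D → E) (a : D) :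
    push α (pointMass a) = pointMass (α a) := by
  classical
  funext b
  rw [push_eq_sum_ite]
  simp only [pointMass, Pi.single_apply]
  rw [Finset.sum_eq_single a]
  · simp [eq_comm]
  · intro c _ hc; simp [hc]
  · simp

theorem satPower_solvableIn_of_solution (D : LCInstance) (k : ℕ) (d : (x : D.Var) → D.dom x)
    (hd : ∀ c, d (D.tgt c) = D.fn c (d (D.src c))) : (D.satPower k).SolvableIn (zMinion 2) := by
  have hid : ∀ c : D.addId.Con, d (D.addId.tgt c) = D.addId.fn c (d (D.addId.src c)) := by
    rintro (c | x)
    · exact hd c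
    · rfl
  refine ⟨fun x => ⟨pointMass fun i => d (x i), sum_pointMass _⟩, ?_⟩
  rintro (c | ⟨x, σ⟩)
  · exact Subtype.ext (Eq.trans (congrArg pointMass (funext fun i => hid (c i)))
      (push_pointMass ((D.satPower k).fn (Sum.inl c)) fun i => d (D.addId.src (c i))).symm)
  · exact Subtype.ext
      (push_pointMass ((D.satPower k).fn (Sum.inr (x, σ))) fun i => d (x i)).symm

theorem satPower_two_solvableIn_iff (m : ℕ∞) (I : TemplateInstance (cosetTemplate m)) :
    (I.toCSP.lc.satPower 2).SolvableIn (zMinion 2) ↔ I.toCSP.Solvable := by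
  constructor
  · intro h
    exact (solves_polMinion _).of_hom (squareToPolCoset m) I (solvableIn_square_of_satPower _ h)
  · rintro ⟨d, hd⟩
    refine satPower_solvableIn_of_solution _ 2 (fun y => match y with
      | Sum.inl x => d x
      | Sum.inr c => ⟨fun i => d (I.toCSP.scope c i), hd c⟩) fun c => rfl

/-! ### Acceptance of restricted instances by BLP+AIP -/

theorem push_comp_apply_of_injective {D E F M : Type} [Fintype D] [AddCommMonoid M] {j : E → F}
    (hj : Function.Injective j) (α : D → E) (f : D → M) (b : E) :
    push (j ∘ α) f (j b) = push α f b := by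
  classical
  simp only [push_eq_sum_ite, Function.comp_apply, hj.eq_iff]

theorem push_eq_of_val_comp {D F M : Type} [Fintype D] [AddCommMonoid M] {s : Set F}
    {α β : D → s} {f : D → M}
    (h : push (fun a => (α a).1) f = push (fun a => (β a).1) f) : push α f = push β f := by
  funext b
  rw [← push_comp_apply_of_injective Subtype.val_injective α,
    ← push_comp_apply_of_injective Subtype.val_injective β]
  exact congrFun h b.1

/-- BLP+AIP accepts a restricted instance if there are assignments `V x` to the variables and `T c`
to the constraints, parametrized by a finite set `K`, and a pair of distributions `ω` on `K` whose
images under these assignments are compatible. -/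
theorem blpAipAccepts_restrict {I : CSPInstance} {S : (x : I.Var) → Set (I.dom x)} {K : Type}
    [Fintype K] (ω : BLPAIPObj K) (V : (x : I.Var) → K → I.dom x)
    (T : (c : I.Con) → K → (i : Fin (I.ar c)) → I.dom (I.scope c i))
    (hV : ∀ x k, V x k ∈ S x) (hT : ∀ c k, T c k ∈ I.rel c)
    (hTS : ∀ c k i, T c k i ∈ S (I.scope c i))
    (hblp : ∀ c i, push (V (I.scope c i)) ω.blp = push (fun k => T c k i) ω.blp)
    (haip : ∀ c i, push (V (I.scope c i)) ω.aip = push (fun k => T c k i) ω.aip) :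
    BLPAIPAccepts (I.restrict S) := by
  let A : (y : (I.restrict S).lc.Var) → K → (I.restrict S).lc.dom y := fun y => match y with
    | Sum.inl x => fun k => ⟨V x k, hV x k⟩
    | Sum.inr c => fun k => ⟨fun i => ⟨T c k i, hTS c k i⟩, hT c k⟩
  refine ⟨fun y => blpAipMinion.map (A y) ω, ?_⟩
  rintro ⟨c, i⟩
  refine Eq.trans ?_ (blpAipMinion.map_comp _ _ ω)
  exact BLPAIPObj.ext (push_eq_of_val_comp (hblp c i)) (push_eq_of_val_comp (haip c i))

/-! ### An unsolvable instance accepted by Singl(BLP+AIP) -/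

/-- The subgroup of `D_4^4` of the tuples with equal second coordinates, and with sum `0` in the
first and in the central coordinate. -/
def rowSubgroup : Subgroup (Fin 4 → D4) where
  carrier := {x | coordQ (x 1) = coordQ (x 0) ∧ coordQ (x 2) = coordQ (x 0) ∧
    coordQ (x 3) = coordQ (x 0) ∧
    coordP (x 0) + coordP (x 1) + coordP (x 2) + coordP (x 3) = 0 ∧
    coordZ (x 0) + coordZ (x 1) + coordZ (x 2) + coordZ (x 3) = 0}
  one_mem' := by simp
  mul_mem' := by
    rintro x y ⟨h1, h2, h3, h4, h5⟩ ⟨k1, k2, k3, k4, k5⟩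
    refine ⟨?_, ?_, ?_, ?_, ?_⟩ <;> simp only [Pi.mul_apply, coordP_mul, coordQ_mul, coordZ_mul]
    · rw [h1, k1]
    · rw [h2, k2]
    · rw [h3, k3]
    · linear_combination h4 + k4
    · rw [k1, k2, k3]
      linear_combination h5 + k5 + coordQ (y 0) * h4
  inv_mem' := by
    rintro x ⟨h1, h2, h3, h4, h5⟩
    refine ⟨?_, ?_, ?_, ?_, ?_⟩ <;> simp only [Pi.inv_apply, coordP_inv, coordQ_inv, coordZ_inv]
    · exact h1
    · exact h2
    · exact h3
    · exact h4
    · rw [h1, h2, h3]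
      linear_combination h5 + coordQ (x 0) * h4

/-- The subgroup of `D_4^4` of the tuples with second coordinates `A, A, B, B`, where the first
coordinates of the two pairs sum up to `B` and `A`, and the central ones sum up to `AB + A`. -/
def twistSubgroup : Subgroup (Fin 4 → D4) where
  carrier := {x | coordQ (x 1) = coordQ (x 0) ∧ coordQ (x 3) = coordQ (x 2) ∧
    coordP (x 0) + coordP (x 1) = coordQ (x 2) ∧ coordP (x 2) + coordP (x 3) = coordQ (x 0) ∧
    coordZ (x 0) + coordZ (x 1) + coordZ (x 2) + coordZ (x 3) =
      coordQ (x 0) * coordQ (x 2) + coordQ (x 0)}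
  one_mem' := by simp
  mul_mem' := by
    rintro x y ⟨h1, h2, h3, h4, h5⟩ ⟨k1, k2, k3, k4, k5⟩
    refine ⟨?_, ?_, ?_, ?_, ?_⟩ <;> simp only [Pi.mul_apply, coordP_mul, coordQ_mul, coordZ_mul]
    · rw [h1, k1]
    · rw [h2, k2]
    · linear_combination h3 + k3
    · linear_combination h4 + k4
    · rw [k1, k2]
      linear_combination h5 + k5 + coordQ (y 0) * h3 + coordQ (y 2) * h4
  inv_mem' := by
    rintro x ⟨h1, h2, h3, h4, h5⟩
    refine ⟨?_, ?_, ?_, ?_, ?_⟩ <;> simp only [Pi.inv_apply, coordP_inv, coordQ_inv, coordZ_inv]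
    · exact h1
    · exact h2
    · exact h3
    · exact h4
    · rw [h1, h2]
      linear_combination h5 + coordQ (x 0) * h3 + coordQ (x 2) * h4 +
        coordQ (x 0) * coordQ (x 2) * (CharTwo.two_eq_zero (R := ZMod 2))

/-- The subgroup of `D_4^4` of the tuples `(y, y', w, w')` with `y`, `y'` and `w`, `w'` congruent
modulo the center, and with sum `0` in the central coordinate. -/
def linkSubgroup : Subgroup (Fin 4 → D4) where
  carrier := {x | coordP (x 1) = coordP (x 0) ∧ coordQ (x 1) = coordQ (x 0) ∧
    coordP (x 3) = coordP (x 2) ∧ coordQ (x 3) = coordQ (x 2) ∧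
    coordZ (x 0) + coordZ (x 1) + coordZ (x 2) + coordZ (x 3) = 0}
  one_mem' := by simp
  mul_mem' := by
    rintro x y ⟨h1, h2, h3, h4, h5⟩ ⟨k1, k2, k3, k4, k5⟩
    refine ⟨?_, ?_, ?_, ?_, ?_⟩ <;> simp only [Pi.mul_apply, coordP_mul, coordQ_mul, coordZ_mul]
    · rw [h1, k1]
    · rw [h2, k2]
    · rw [h3, k3]
    · rw [h4, k4]
    · rw [h1, h3, k2, k4]
      linear_combination h5 + k5 + (coordP (x 0) * coordQ (y 0) + coordP (x 2) * coordQ (y 2)) *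
        (CharTwo.two_eq_zero (R := ZMod 2))
  inv_mem' := by
    rintro x ⟨h1, h2, h3, h4, h5⟩
    refine ⟨?_, ?_, ?_, ?_, ?_⟩ <;> simp only [Pi.inv_apply, coordP_inv, coordQ_inv, coordZ_inv]
    · exact h1
    · exact h2
    · exact h3
    · exact h4
    · rw [h1, h2, h3, h4]
      linear_combination h5 + (coordP (x 0) * coordQ (x 0) + coordP (x 2) * coordQ (x 2)) *
        (CharTwo.two_eq_zero (R := ZMod 2))

/-- The coset of `linkSubgroup` given by sum `1` in the central coordinate. -/
def linkSet : Set (Fin 4 → D4) :=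
  {x | coordP (x 1) = coordP (x 0) ∧ coordQ (x 1) = coordQ (x 0) ∧
    coordP (x 3) = coordP (x 2) ∧ coordQ (x 3) = coordQ (x 2) ∧
    coordZ (x 0) + coordZ (x 1) + coordZ (x 2) + coordZ (x 3) = 1}

theorem isCoset_linkSet : IsCoset linkSet := by
  -- A central involution in a single entry changes the central sum by `1` and nothing else.
  refine ⟨linkSubgroup, ![ofCoords 0 0 1, 1, 1, 1], ?_⟩
  ext x
  constructor
  · rintro ⟨h1, h2, h3, h4, h5⟩
    refine ⟨![ofCoords 0 0 1, 1, 1, 1] * x, ⟨?_, ?_, ?_, ?_, ?_⟩, ?_⟩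
    · simpa using h1
    · simpa using h2
    · simpa using h3
    · simpa using h4
    · simp only [Pi.mul_apply, coordZ_mul, Matrix.cons_val, coordZ_ofCoords, coordP_ofCoords,
        coordZ_one, coordP_one]
      linear_combination h5 + CharTwo.two_eq_zero (R := ZMod 2)
    · rw [← mul_assoc]
      have e : (![ofCoords 0 0 1, 1, 1, 1] * ![ofCoords 0 0 1, 1, 1, 1] : Fin 4 → D4) = 1 := by
        decide
      rw [e, one_mul]
  · rintro ⟨h, ⟨h1, h2, h3, h4, h5⟩, rfl⟩
    refine ⟨?_, ?_, ?_, ?_, ?_⟩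
    · simpa using h1
    · simpa using h2
    · simpa using h3
    · simpa using h4
    · simp only [Pi.mul_apply, coordZ_mul, Matrix.cons_val, coordZ_ofCoords, coordP_ofCoords,
        coordZ_one, coordP_one]
      linear_combination h5

/-- The relations of the instance: `some (e, b)` are the constraints inside the copy `e`, and `none`
links the two copies. -/
def foolRel : Option (Bool × Bool) → Set (Fin 4 → D4)
  | some (_, false) => rowSubgroup
  | some (_, true) => twistSubgroup
  | none => linkSet

theorem isCoset_foolRel : ∀ c, IsCoset (foolRel c)
  | some (_, false) => isCoset_coe _
  | some (_, true) => isCoset_coe _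
  | none => isCoset_linkSet

instance decidable_mem_foolRel (c : Option (Bool × Bool)) (x : Fin 4 → D4) :
    Decidable (x ∈ foolRel c) :=
  match c with
  | some (_, false) => inferInstanceAs (Decidable (_ ∧ _ ∧ _ ∧ _ ∧ _))
  | some (_, true) => inferInstanceAs (Decidable (_ ∧ _ ∧ _ ∧ _ ∧ _))
  | none => inferInstanceAs (Decidable (_ ∧ _ ∧ _ ∧ _ ∧ _))

/-- The scopes of the instance. -/
def foolScope : Option (Bool × Bool) → Fin 4 → Bool × Fin 5
  | some (e, false) => ![(e, 0), (e, 1), (e, 2), (e, 3)]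
  | some (e, true) => ![(e, 4), (e, 1), (e, 2), (e, 3)]
  | none => ![(false, 0), (false, 4), (true, 0), (true, 4)]

/-- An unsolvable instance with relations of arity `4`. -/
def foolInstance (m : ℕ∞) (hm : 4 ≤ m) : TemplateInstance (cosetTemplate m) where
  Var := Bool × Fin 5
  Con := Option (Bool × Bool)
  sym := fun c => ⟨⟨4, hm⟩, foolRel c, isCoset_foolRel c⟩
  scope := foolScope

/-- The row constraint makes all second coordinates in a copy equal, so the twist `AB + A` becomes
`A² + A = 0` and the variables `0` and `4` have the same central coordinate. The link then reads `0
= 1`. -/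
theorem foolInstance_not_solvable (m : ℕ∞) (hm : 4 ≤ m) :
    ¬ (foolInstance m hm).toCSP.Solvable := by
  rintro ⟨d, hd⟩
  replace hd : ∀ c, (fun i => d (foolScope c i) : Fin 4 → D4) ∈ foolRel c := hd
  have key : ∀ e, coordZ (d (e, 0)) = coordZ (d (e, 4)) := fun e => by
    obtain ⟨h1, h2, h3, h4, h5⟩ := hd (some (e, false))
    obtain ⟨k1, k2, k3, k4, k5⟩ := hd (some (e, true))
    simp only [foolScope, Matrix.cons_val] at *
    have hq : ∀ c : ZMod 2, c * c + c = 0 := by decide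
    rw [← k1, h1, h2, hq] at k5
    linear_combination h5 - k5
  obtain ⟨-, -, -, -, h⟩ := hd none
  simp only [foolScope, Matrix.cons_val, key] at h
  rw [CharTwo.add_self_eq_zero, zero_add, CharTwo.add_self_eq_zero] at h
  exact zero_ne_one h

/-- A solution of the constraints inside a copy with value `a` at the variable `j`. -/
def copySolution (j : Fin 5) (a : D4) : Fin 5 → D4 :=
  let q := coordQ a
  -- The first coordinates are `b, b + q, b', b' + q, b`; the free parameters are chosen so that
  -- entry `j` equals `coordP a`.
  let b : ZMod 2 := ![coordP a, coordP a + q, 0, 0, coordP a] j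
  let b' : ZMod 2 := ![0, 0, coordP a, coordP a + q, 0] j
  ![ofCoords b q (coordZ a), ofCoords (b + q) q (coordZ a), ofCoords b' q (coordZ a),
    ofCoords (b' + q) q (coordZ a), ofCoords b q (coordZ a)]

/-- The values of the variables of a copy in the relaxed solution. -/
def relaxedVar (k : Fin 3 × Bool) : Fin 5 → D4 :=
  let p : ZMod 2 := ![1, 0, 1] k.1
  let q : ZMod 2 := ![0, 1, 1] k.1
  let z : ZMod 2 := if k.2 then 1 else 0
  ![ofCoords p q 0, ofCoords 0 q z, ofCoords p q 0, ofCoords 0 q z, ofCoords p q 1]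

/-- The tuples of the second constraint of a copy in the relaxed solution. -/
def relaxedTwist (k : Fin 3 × Bool) : Fin 4 → D4 :=
  let p : ZMod 2 := ![0, 1, 1] k.1
  let q : ZMod 2 := ![1, 0, 1] k.1
  let z : ZMod 2 := if k.2 then 1 else 0
  -- The last two entries use the first two types exchanged, so that `(A, B)` runs through `(0,1),
  -- (1,0), (1,1)`. There `AB + A = 1 + B`, which the central coordinate `1` of variable `4` and the
  -- shift by `q = B` supply.
  ![relaxedVar k 4, relaxedVar k 1, ofCoords p q 0, ofCoords 0 q (z + q)]

/-- The distributions used in the relaxed solution. -/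
noncomputable def relaxedDistr : BLPAIPObj (Fin 3 × Bool) where
  blp := fun _ => 1 / 6
  -- Equal weights on the first two types make the exchange invisible. At the last entry the weights
  -- `1` and `-1` with `q = 1` cancel, which hides the shift of the central coordinate; for `blp`
  -- uniformity hides both.
  aip := fun k => if k.2 then 0 else ![1, 1, -1] k.1
  nonneg := fun _ => by norm_num
  sum_blp := by simp
  sum_aip := by decide
  support := fun _ h => by norm_num at h

/-- Equality of real-valued uniform images reduces to counting fibres, which is decidable. -/
theorem push_const_eq {K : Type} [Fintype K] (r : ℝ) {α β : K → D4}
    (h : ∀ b, (Finset.univ.filter fun k => α k = b).card =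
      (Finset.univ.filter fun k => β k = b).card) :
    push α (fun _ => r) = push β (fun _ => r) := by
  funext b
  rw [push_eq_sum_ite, push_eq_sum_ite, ← Finset.sum_filter, ← Finset.sum_filter,
    Finset.sum_const, Finset.sum_const, h]

theorem push_relaxedTwist_blp (i : Fin 4) :
    push (fun k => relaxedVar k (![4, 1, 2, 3] i)) relaxedDistr.blp =
      push (fun k => relaxedTwist k i) relaxedDistr.blp := by
  refine push_const_eq _ ?_
  revert i
  decide

theorem push_relaxedTwist_aip (i : Fin 4) :
    push (fun k => relaxedVar k (![4, 1, 2, 3] i)) relaxedDistr.aip =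
      push (fun k => relaxedTwist k i) relaxedDistr.aip := by
  funext b
  rw [push_eq_sum_ite, push_eq_sum_ite]
  simp only [relaxedDistr]
  revert i b
  decide

theorem copySolution_self (j : Fin 5) (a : D4) : copySolution j a j = a := by
  revert j a; decide

/-- The values of all variables in the relaxed solution with value `a` at the variable `(e, j)`. -/
def relaxedAssign (e : Bool) (j : Fin 5) (a : D4) (x : Bool × Fin 5) (k : Fin 3 × Bool) : D4 :=
  if x.1 = e then copySolution j a x.2 else relaxedVar k x.2

/-- The tuples of all constraints in the relaxed solution with value `a` at the variable
`(e, j)`. -/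
def relaxedTuple (e : Bool) (j : Fin 5) (a : D4) (c : Option (Bool × Bool)) (k : Fin 3 × Bool)
    (i : Fin 4) : D4 :=
  if c = some (!e, true) then relaxedTwist k i else relaxedAssign e j a (foolScope c i) k

theorem relaxedTuple_mem (e : Bool) (j : Fin 5) (a : D4) (c : Option (Bool × Bool))
    (k : Fin 3 × Bool) : relaxedTuple e j a c k ∈ foolRel c := by
  revert e j a c k
  decide

theorem push_relaxedTuple {M : Type} [AddCommMonoid M] (ω : Fin 3 × Bool → M)
    (hω : ∀ i, push (fun k => relaxedVar k (![4, 1, 2, 3] i)) ω =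
      push (fun k => relaxedTwist k i) ω) (e : Bool) (j : Fin 5) (a : D4)
    (c : Option (Bool × Bool)) (i : Fin 4) :
    push (relaxedAssign e j a (foolScope c i)) ω = push (fun k => relaxedTuple e j a c k i) ω := by
  by_cases hc : c = some (!e, true)
  · subst hc
    have h1 : relaxedAssign e j a (foolScope (some (!e, true)) i) =
        fun k => relaxedVar k (![4, 1, 2, 3] i) := by
      funext k
      fin_cases i <;> simp [relaxedAssign, foolScope]
    simp only [h1, hω, relaxedTuple, if_true]
  · simp only [relaxedTuple, hc, if_false]

/-- Copy `e` takes an actual solution through the prescribed value, contributing `0` to the link;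
the other copy takes the relaxed solution, with central coordinates `0` and `1` at its variables `0`
and `4`, and contributes `1`. -/
theorem blpAipAccepts_foolInstance (m : ℕ∞) (hm : 4 ≤ m) (e : Bool) (j : Fin 5) (a : D4)
    (S : Bool × Fin 5 → Set D4) (hS : ∀ x b, (x = (e, j) → b = a) → b ∈ S x) :
    BLPAIPAccepts ((foolInstance m hm).toCSP.restrict S) := by
  have hmem : ∀ x k, relaxedAssign e j a x k ∈ S x := fun x k => hS _ _ fun hx => by
    subst hx
    exact (if_pos rfl).trans (copySolution_self j a)
  have hmem' : ∀ c k i, relaxedTuple e j a c k i ∈ S (foolScope c i) := fun c k i => by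
    by_cases hc : c = some (!e, true)
    · subst hc
      have hne : foolScope (some (!e, true)) i ≠ (e, j) := by
        fin_cases i <;> simp [foolScope]
      exact hS _ _ fun h => absurd h hne
    · simp only [relaxedTuple, hc, if_false]
      exact hmem _ _
  exact blpAipAccepts_restrict (I := (foolInstance m hm).toCSP)
    relaxedDistr (relaxedAssign e j a) (relaxedTuple e j a) hmem (relaxedTuple_mem e j a) hmem'
    (push_relaxedTuple _ push_relaxedTwist_blp e j a)
    (push_relaxedTuple _ push_relaxedTwist_aip e j a)

theorem mem_update_univ {ι α : Type} [DecidableEq ι] {x₀ x : ι} {a b : α} (h : x = x₀ → b = a) :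
    b ∈ Function.update (fun _ : ι => (Set.univ : Set α)) x₀ {a} x := by
  by_cases hx : x = x₀
  · subst hx
    simp [h rfl]
  · simp [hx]

theorem foolInstance_singlAccepts (m : ℕ∞) (hm : 4 ≤ m) :
    CSPInstance.SinglAccepts BLPAIPAccepts (foolInstance m hm).toCSP := by
  classical
  -- No value is ever removed: the full domains are already stable.
  refine ⟨fun _ => Set.univ, .refl, fun _ => ⟨(1 : D4), trivial⟩, ?_⟩
  rintro ⟨T, ⟨e, j⟩, a, -, hrej, -⟩
  exact hrej (blpAipAccepts_foolInstance m hm e j a _ fun x b h => mem_update_univ h)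

end SolvingSquare

open SolvingSquare in
theorem mainTheorem4 :
    -- rounding forms exist; the strictly upper triangular form is one
    (∀ N : ℕ, ∃ Q : LinearMap.BilinForm (ZMod 2) (Fin N → ZMod 2),
      (∀ v w, Q v w = ∑ i, ∑ j ∈ Finset.Ioi i, v i * w j) ∧ IsRoundingForm Q) ∧
    -- every vector solution is rounded to a solution in `M` by any such form
    (∀ (D : LCInstance) (N : ℕ) (Q : LinearMap.BilinForm (ZMod 2) (Fin N → ZMod 2))
      (i : Fin N → ZMod 2) (v : (x : D.Var) → D.dom x → Fin N → ZMod 2),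
      IsRoundingForm Q → IsVectorSolution D i v →
      ∃ s : (x : D.Var) → SquareObj (D.dom x),
        D.IsSolutionIn squareMinion s ∧
        (∀ x a, (s x).f a = weight (v x a)) ∧
        (∀ x a, (s x).g (a, a) = Q (v x a) (v x a - i)) ∧
        (∀ x a b, a ≠ b → (s x).g (a, b) = Q (v x a) (v x b)) ∧
        (∀ x a, ∑ b, (s x).g (a, b) = 0)) ∧
    -- the same rule is a minion homomorphism from `V_2-Z_2` to `M`
    (∀ Q : (N : ℕ) → LinearMap.BilinForm (ZMod 2) (Fin N → ZMod 2),
      (∀ N, IsRoundingForm (Q N)) →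
      ∃ ξ : MinionHom (vectorMinion 2 2) squareMinion,
        ∀ (D : Type) [Fintype D] (t : VectorObj 2 2 D) (s : SquareObj D), s = ξ.app D t →
          (∀ a, s.f a = weight (t.v a)) ∧
          (∀ a, s.g (a, a) = Q t.N (t.v a) (t.v a - t.i)) ∧
          (∀ a b, a ≠ b → s.g (a, b) = Q t.N (t.v a) (t.v b)) ∧
          (∀ a, ∑ b, s.g (a, b) = 0)) ∧
    -- `M` is the polymorphism minion of `D_4` with all subgroups and constants
    (∃ η : MinionHom (polMinion subgroupTemplate) squareMinion,
      ∀ (D : Type) [Fintype D], Function.Bijective (η.app D)) ∧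
    -- the polymorphism minion of `D_4` with all cosets is the subminion of `M` given by vanishing
    -- row sums, and `M` maps homomorphically to it
    (∃ η : MinionHom (polMinion (cosetTemplate ⊤)) squareMinion,
      ∀ (D : Type) [Fintype D], Function.Injective (η.app D) ∧
        ∀ s : SquareObj D, (∃ F, η.app D F = s) ↔ ∀ a, ∑ b, s.g (a, b) = 0) ∧
    (∀ m : ℕ∞, Nonempty (MinionHom squareMinion (polMinion (cosetTemplate m)))) ∧
    -- hence `V_2-Z_2` maps to it, every solution in `V_2-Z_2` gives one in it, and `V_2-Z_2`
    -- solves the coset CSP of `D_4`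
    (∀ m : ℕ∞, Nonempty (MinionHom (vectorMinion 2 2) (polMinion (cosetTemplate m))) ∧
      (∀ D : LCInstance, D.SolvableIn (vectorMinion 2 2) →
        D.SolvableIn (polMinion (cosetTemplate m))) ∧
      Solves (vectorMinion 2 2) (cosetTemplate m)) ∧
    -- the second level of the `Z_2` relaxation decides the coset CSP of `D_4`
    (∀ (m : ℕ∞) (I : TemplateInstance (cosetTemplate m)),
      (I.toCSP.lc.satPower 2).SolvableIn (zMinion 2) ↔ I.toCSP.Solvable) ∧
    -- the coset CSP of `D_4`, already with relations of arity at most 4, fools Singl(BLP+AIP)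
    (∀ m : ℕ∞, 4 ≤ m → ∃ I : TemplateInstance (cosetTemplate m),
      CSPInstance.SinglAccepts BLPAIPAccepts I.toCSP ∧ ¬ I.toCSP.Solvable) := by
  refine ⟨exists_upper_roundingForm, exists_rounding_of_isVectorSolution, exists_rounding_hom,
    exists_polSubgroup_iso, exists_polCoset_embedding, fun m => ⟨squareToPolCoset m⟩, fun m => ?_,
    satPower_two_solvableIn_iff, fun m hm =>
      ⟨foolInstance m hm, foolInstance_singlAccepts m hm, foolInstance_not_solvable m hm⟩⟩
  obtain ⟨ξ⟩ := nonempty_vectorMinion_hom_square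
  exact ⟨⟨(squareToPolCoset m).comp ξ⟩, fun D hD => hD.map ((squareToPolCoset m).comp ξ),
    (solves_polMinion _).of_hom ((squareToPolCoset m).comp ξ)⟩
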